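/- **The system.** The finite types are $0$ and, for types $\rho,\tau$, the type $\rho\to\tau$; write $1=0\to0$ and $2=1\to0$. The terms are built by application from typed variables and the constants $0$, the successor $S$, the combinators $\Pi_{\rho,\tau}$ and $\Sigma_{\delta,\rho,\tau}$ in all types, and the recursor $R_0$ for primitive recursion with values of type $0$. The formulas are those of many-sorted predicate logic whose only primitive relation is equality $=_0$ at type $0$; equality at higher types is defined pointwise, i.e. for $\rho=\tau_1\to\dots\to\tau_k\to 0$, $x=_\rho y$ stands for $(\forall z_1^{\tau_1}\dots z_k^{\tau_k})(xz_1\dots z_k=_0yz_1\dots z_k)$. The system $\mathsf{RCA}_0^\omega$ ($=\mathsf{E\text{-}PRA}^\omega+\mathsf{QF\text{-}AC}^{1,0}$) has classical logic and, with arbitrary parameters, the following axioms: the equality axioms for $=_0$; the successor axioms; the defining axioms $\Pi xy=x$, $\Sigma xyz=xz(yz)$, $R_0 0 a b=_0a$ and $R_0(Sn)ab=_0b(R_0nab)n$; the axiom of extensionality $x=_\rho y\to \varphi(x)=_\tau\varphi(y)$ for $\varphi$ of type $\rho\to\tau$, in all types; induction for quantifier-free formulas; and $\mathsf{QF\text{-}AC}^{1,0}$,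 i.e. $(\forall f^1)(\exists n^0)\varphi_0(f,n)\to(\exists Y^2)(\forall f^1)\varphi_0(f,Y(f))$ for quantifier-free $\varphi_0$. **The principles.** A set $X\subseteq\mathbb N$ is given by a binary characteristic function $X^1$, and it codes the binary relation $i\le_X j:\leftrightarrow (i,j)\in X$, where $(i,j)=(i+j)^2+i$. Its field consists of the $i$ with $(i,i)\in X$, and $i<_Xj$ means $(i,j)\in X\wedge(j,i)\notin X$. The formula $\mathrm{LO}_\infty(X)$ says that $X$ is an infinite linear order: if $i\le_Xj$, then $i$ and $j$ are in the field; $\le_X$ is transitive and antisymmetric, and total on the field; and the field is not bounded by any number. For $\Psi$ of type $1\to1$, let $A(\Psi)$ be the formula $$(\forall X^1)\big[\mathrm{LO}_\infty(X)\to(\forall n^0)\,\Psi(X)(n)<_X\Psi(X)(n+1)\ \vee\ (\forall m^0)\,\Psi(X)(m+1)<_X\Psi(X)(m)\big].$$ The principle $\mathsf{UADS}$ is $(\exists\Psi^{1\to1})A(\Psi)$. For $\mu$ of type $2$, let $\mathsf{MU}(\mu)$ be the formula $$(\forall f^1)\big[(\exists n^0)f(n)=0\to f(\mu(f))=0\big].$$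 The principle $(\mu^2)$ is $(\exists\mu^2)\,\mathsf{MU}(\mu)$. **Theorem.** $\mathsf{RCA}_0^\omega$ proves $\mathsf{UADS}\leftrightarrow(\mu^2)$, and this equivalence is explicit: there are closed terms $t$ and $s$ of the language such that $\mathsf{RCA}_0^\omega$ proves $$(\forall\Psi^{1\to1})\big[A(\Psi)\to\mathsf{MU}(t(\Psi))\big]\qquad\text{and}\qquad(\forall\mu^2)\big[\mathsf{MU}(\mu)\to A(s(\mu))\big].$$ -/

import Mathlib

/-!
The system `RCA₀^ω` of higher-order reverse mathematics, i.e. `E-PRA^ω + QF-AC^{1,0}`, as a formal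
system: typed combinatory terms, many-sorted first-order formulas whose only primitive relation is
equality at type `0`, and a natural deduction calculus for classical logic.  Variables are
well-typed de Bruijn indices.
-/

namespace RCAω

/-! ### Finite types -/

/-- The finite types: `0` and `ρ → τ`. -/
inductive Ty : Type
  | nat : Ty
  | arr : Ty → Ty → Ty

infixr:60 " ⟶ₜ " => Ty.arr

/-- The type `1 = 0 → 0` of number sequences. -/
abbrev Ty.one : Ty := Ty.nat ⟶ₜ Ty.nat

/-- The type `2 = (0 → 0) → 0`. -/
abbrev Ty.two : Ty := Ty.one ⟶ₜ Ty.nat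

/-- `Var Γ σ`: the variables of type `σ` in the context `Γ` (a list of types). -/
inductive Var : List Ty → Ty → Type
  | zero {Γ : List Ty} {σ : Ty} : Var (σ :: Γ) σ
  | succ {Γ : List Ty} {σ τ : Ty} : Var Γ σ → Var (τ :: Γ) σ

/-! ### Terms -/

/-- The constants: zero, successor, the combinators `Π` and `Σ` in all types, and the recursor
`R₀` for primitive recursion with values of type `0`. -/
inductive Cst : Ty → Type
  | zero : Cst Ty.nat
  | succ : Cst Ty.one
  | proj (ρ τ : Ty) : Cst (ρ ⟶ₜ τ ⟶ₜ ρ)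
  | comb (δ ρ τ : Ty) : Cst ((δ ⟶ₜ ρ ⟶ₜ τ) ⟶ₜ (δ ⟶ₜ ρ) ⟶ₜ δ ⟶ₜ τ)
  | recursor : Cst (Ty.nat ⟶ₜ Ty.nat ⟶ₜ (Ty.nat ⟶ₜ Ty.nat ⟶ₜ Ty.nat) ⟶ₜ Ty.nat)

/-- `Tm Γ σ`: the terms of type `σ` with free variables in `Γ`.  The closed terms are `Tm [] σ`. -/
inductive Tm (Γ : List Ty) : Ty → Type
  | var {σ : Ty} : Var Γ σ → Tm Γ σ
  | cst {σ : Ty} : Cst σ → Tm Γ σ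
  | app {σ τ : Ty} : Tm Γ (σ ⟶ₜ τ) → Tm Γ σ → Tm Γ τ

infixl:90 " ⬝ " => Tm.app

/-- Simultaneous substitutions of terms over `Δ` for the variables in `Γ`. -/
abbrev Sub (Γ Δ : List Ty) : Type := ∀ σ : Ty, Var Γ σ → Tm Δ σ

def Tm.subst {Γ Δ : List Ty} (θ : Sub Γ Δ) : {σ : Ty} → Tm Γ σ → Tm Δ σ
  | _, .var v => θ _ v
  | _, .cst c => .cst c
  | _, .app s t => .app (s.subst θ) (t.subst θ)

/-- The weakening substitution: add one fresh variable to the context. -/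
def Sub.wk {Γ : List Ty} (τ : Ty) : Sub Γ (τ :: Γ) := fun _ v => Tm.var v.succ

def Tm.wk {Γ : List Ty} {σ : Ty} (τ : Ty) (t : Tm Γ σ) : Tm (τ :: Γ) σ := t.subst (Sub.wk τ)

/-- The substitution for the empty context. -/
def Sub.nil {Δ : List Ty} : Sub [] Δ := nofun

/-- A closed term, regarded as a term over an arbitrary context. -/
def Tm.ofClosed {Γ : List Ty} {σ : Ty} (t : Tm [] σ) : Tm Γ σ := t.subst Sub.nil

def Sub.id (Γ : List Ty) : Sub Γ Γ := fun _ v => Tm.var v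

/-- Extend a substitution by a term for the newest variable. -/
def Sub.cons {Γ Δ : List Ty} {τ : Ty} (t : Tm Δ τ) (θ : Sub Γ Δ) : Sub (τ :: Γ) Δ
  | _, .zero => t
  | _, .succ v => θ _ v

/-- Push a substitution under a binder. -/
def Sub.lift {Γ Δ : List Ty} (τ : Ty) (θ : Sub Γ Δ) : Sub (τ :: Γ) (τ :: Δ) :=
  Sub.cons (Tm.var Var.zero) (fun σ v => (θ σ v).wk τ)

/-- The newest, second newest, third newest variable. -/
abbrev x0 {Γ : List Ty} {σ : Ty} : Tm (σ :: Γ) σ := Tm.var Var.zero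
abbrev x1 {Γ : List Ty} {σ τ : Ty} : Tm (τ :: σ :: Γ) σ := Tm.var Var.zero.succ
abbrev x2 {Γ : List Ty} {σ τ υ : Ty} : Tm (υ :: τ :: σ :: Γ) σ := Tm.var Var.zero.succ.succ

section Arithmetic

variable {Γ : List Ty}

abbrev tzero : Tm Γ Ty.nat := Tm.cst Cst.zero

/-- `S t` -/
abbrev tsucc (t : Tm Γ Ty.nat) : Tm Γ Ty.nat := Tm.cst Cst.succ ⬝ t

abbrev tone : Tm Γ Ty.nat := tsucc tzero

/-- `Π_{ρ,τ}` -/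
abbrev tproj (ρ τ : Ty) : Tm Γ (ρ ⟶ₜ τ ⟶ₜ ρ) := Tm.cst (Cst.proj ρ τ)

/-- `Σ_{δ,ρ,τ}` -/
abbrev tcomb (δ ρ τ : Ty) : Tm Γ ((δ ⟶ₜ ρ ⟶ₜ τ) ⟶ₜ (δ ⟶ₜ ρ) ⟶ₜ δ ⟶ₜ τ) :=
  Tm.cst (Cst.comb δ ρ τ)

/-- `R₀` -/
abbrev trec : Tm Γ (Ty.nat ⟶ₜ Ty.nat ⟶ₜ (Ty.nat ⟶ₜ Ty.nat ⟶ₜ Ty.nat) ⟶ₜ Ty.nat) :=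
  Tm.cst Cst.recursor

/-- `λ p q. t p`, for `t` of type `1`. -/
def tconst2 (t : Tm Γ Ty.one) : Tm Γ (Ty.nat ⟶ₜ Ty.nat ⟶ₜ Ty.nat) :=
  tcomb _ _ _ ⬝ (tproj _ _ ⬝ tproj _ _) ⬝ t

/-- Addition `a + b`, by recursion on `b`, with step `λ p q. S p`. -/
def tadd (a b : Tm Γ Ty.nat) : Tm Γ Ty.nat := trec ⬝ b ⬝ a ⬝ tconst2 (Tm.cst Cst.succ)

/-- Multiplication `a · b`, by recursion on `b`, with step `λ p q. p + a`. -/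
def tmul (a b : Tm Γ Ty.nat) : Tm Γ Ty.nat :=
  trec ⬝ b ⬝ tzero ⬝
    tconst2 (tcomb _ _ _ ⬝ (trec ⬝ a) ⬝ (tproj _ _ ⬝ tconst2 (Tm.cst Cst.succ)))

/-- The usual pairing of second-order arithmetic: `(i, j) = (i + j)² + i`. -/
def tpair (i j : Tm Γ Ty.nat) : Tm Γ Ty.nat := tadd (tmul (tadd i j) (tadd i j)) i

end Arithmetic

/-! ### Formulas -/

/-- Formulas with free variables in `Γ`.  The prime formulas are equations of type `0`. -/
inductive Fml : List Ty → Type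
  | eq {Γ : List Ty} : Tm Γ Ty.nat → Tm Γ Ty.nat → Fml Γ
  | fls {Γ : List Ty} : Fml Γ
  | imp {Γ : List Ty} : Fml Γ → Fml Γ → Fml Γ
  | all {Γ : List Ty} (σ : Ty) : Fml (σ :: Γ) → Fml Γ

infix:70 " ≐ " => Fml.eq
infixr:50 " ⊃ₑ " => Fml.imp

section Connectives

variable {Γ : List Ty}

/-! The remaining connectives, by their classical definitions. -/

abbrev Fml.neg (φ : Fml Γ) : Fml Γ := φ ⊃ₑ Fml.fls
abbrev Fml.and (φ ψ : Fml Γ) : Fml Γ := (φ ⊃ₑ ψ.neg).neg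
abbrev Fml.or (φ ψ : Fml Γ) : Fml Γ := φ.neg ⊃ₑ ψ
abbrev Fml.iff (φ ψ : Fml Γ) : Fml Γ := (φ ⊃ₑ ψ).and (ψ ⊃ₑ φ)
abbrev Fml.ex (σ : Ty) (φ : Fml (σ :: Γ)) : Fml Γ := (Fml.all σ φ.neg).neg

end Connectives

def Fml.subst : {Γ Δ : List Ty} → Sub Γ Δ → Fml Γ → Fml Δ
  | _, _, θ, .eq s t => .eq (s.subst θ) (t.subst θ)
  | _, _, _, .fls => .fls
  | _, _, θ, .imp φ ψ => .imp (φ.subst θ) (ψ.subst θ)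
  | _, _, θ, .all σ φ => .all σ (φ.subst (θ.lift σ))

def Fml.wk {Γ : List Ty} (τ : Ty) (φ : Fml Γ) : Fml (τ :: Γ) := φ.subst (Sub.wk τ)

/-- `φ[t]`: substitute `t` for the newest variable. -/
def Fml.inst {Γ : List Ty} {σ : Ty} (φ : Fml (σ :: Γ)) (t : Tm Γ σ) : Fml Γ :=
  φ.subst (Sub.cons t (Sub.id Γ))

/-- Quantifier-free formulas. -/
inductive Fml.QF : {Γ : List Ty} → Fml Γ → Prop
  | eq {Γ : List Ty} (s t : Tm Γ Ty.nat) : (s ≐ t).QF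
  | fls {Γ : List Ty} : (Fml.fls : Fml Γ).QF
  | imp {Γ : List Ty} {φ ψ : Fml Γ} : φ.QF → ψ.QF → (φ ⊃ₑ ψ).QF

/-- Equality at type `ρ`, defined pointwise: `s =_ρ t` is `(∀ z₁ … z_k) s z₁ … z_k =₀ t z₁ … z_k`. -/
def Fml.eqT : {Γ : List Ty} → (ρ : Ty) → Tm Γ ρ → Tm Γ ρ → Fml Γ
  | _, .nat, s, t => s ≐ t
  | _, .arr σ τ, s, t => .all σ (Fml.eqT τ (s.wk σ ⬝ x0) (t.wk σ ⬝ x0))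

/-! ### The axioms and the calculus -/

/-- The non-logical axioms of `RCA₀^ω = E-PRA^ω + QF-AC^{1,0}`, with arbitrary parameters. -/
inductive Ax : {Γ : List Ty} → Fml Γ → Prop
  /- equality of type `0` -/
  | refl {Γ : List Ty} (s : Tm Γ Ty.nat) : Ax (s ≐ s)
  | symm {Γ : List Ty} (s t : Tm Γ Ty.nat) : Ax (s ≐ t ⊃ₑ t ≐ s)
  | trans {Γ : List Ty} (s t r : Tm Γ Ty.nat) : Ax (s ≐ t ⊃ₑ t ≐ r ⊃ₑ s ≐ r)
  /- successor -/
  | succ_ne_zero {Γ : List Ty} (s : Tm Γ Ty.nat) : Ax (tsucc s ≐ tzero).neg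
  | succ_inj {Γ : List Ty} (s t : Tm Γ Ty.nat) : Ax (tsucc s ≐ tsucc t ⊃ₑ s ≐ t)
  /- combinators and recursor -/
  | proj {Γ : List Ty} {ρ τ : Ty} (a : Tm Γ ρ) (b : Tm Γ τ) :
      Ax (Fml.eqT ρ (tproj ρ τ ⬝ a ⬝ b) a)
  | comb {Γ : List Ty} {δ ρ τ : Ty} (a : Tm Γ (δ ⟶ₜ ρ ⟶ₜ τ)) (b : Tm Γ (δ ⟶ₜ ρ)) (c : Tm Γ δ) :
      Ax (Fml.eqT τ (tcomb δ ρ τ ⬝ a ⬝ b ⬝ c) (a ⬝ c ⬝ (b ⬝ c)))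
  | rec_zero {Γ : List Ty} (a : Tm Γ Ty.nat) (b : Tm Γ (Ty.nat ⟶ₜ Ty.nat ⟶ₜ Ty.nat)) :
      Ax (trec ⬝ tzero ⬝ a ⬝ b ≐ a)
  | rec_succ {Γ : List Ty} (n a : Tm Γ Ty.nat) (b : Tm Γ (Ty.nat ⟶ₜ Ty.nat ⟶ₜ Ty.nat)) :
      Ax (trec ⬝ tsucc n ⬝ a ⬝ b ≐ b ⬝ (trec ⬝ n ⬝ a ⬝ b) ⬝ n)
  /- the extensionality scheme, in all types -/
  | ext {Γ : List Ty} {ρ τ : Ty} (f : Tm Γ (ρ ⟶ₜ τ)) (a b : Tm Γ ρ) :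
      Ax (Fml.eqT ρ a b ⊃ₑ Fml.eqT τ (f ⬝ a) (f ⬝ b))
  /- quantifier-free induction: `φ(0) → (∀ n)(φ(n) → φ(S n)) → (∀ n) φ(n)` -/
  | ind {Γ : List Ty} (φ : Fml (Ty.nat :: Γ)) : φ.QF →
      Ax (φ.inst tzero ⊃ₑ
        Fml.all Ty.nat (φ ⊃ₑ φ.subst (Sub.cons (tsucc x0) (Sub.wk Ty.nat))) ⊃ₑ
        Fml.all Ty.nat φ)
  /- `QF-AC^{1,0}`: `(∀ f¹)(∃ n⁰) φ(f, n) → (∃ Y²)(∀ f¹) φ(f, Y f)`; in `φ`, the number `n` is the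
  newest variable and `f` the second newest one -/
  | choice {Γ : List Ty} (φ : Fml (Ty.nat :: Ty.one :: Γ)) : φ.QF →
      Ax (Fml.all Ty.one (Fml.ex Ty.nat φ) ⊃ₑ
        Fml.ex Ty.two (Fml.all Ty.one (φ.subst
          (Sub.cons (x1 ⬝ x0) (Sub.cons x0 (fun _ v => Tm.var v.succ.succ))))))

/-- `Prv Δ φ`: the formula `φ` is derivable in `RCA₀^ω` from the open assumptions `Δ`, by
natural deduction for many-sorted classical predicate logic. -/
inductive Prv : {Γ : List Ty} → List (Fml Γ) → Fml Γ → Prop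
  | ax {Γ : List Ty} {Δ : List (Fml Γ)} {φ : Fml Γ} : Ax φ → Prv Δ φ
  | hyp {Γ : List Ty} {Δ : List (Fml Γ)} {φ : Fml Γ} : φ ∈ Δ → Prv Δ φ
  | impI {Γ : List Ty} {Δ : List (Fml Γ)} {φ ψ : Fml Γ} : Prv (φ :: Δ) ψ → Prv Δ (φ ⊃ₑ ψ)
  | impE {Γ : List Ty} {Δ : List (Fml Γ)} {φ ψ : Fml Γ} : Prv Δ (φ ⊃ₑ ψ) → Prv Δ φ → Prv Δ ψ
  | raa {Γ : List Ty} {Δ : List (Fml Γ)} {φ : Fml Γ} : Prv (φ.neg :: Δ) Fml.fls → Prv Δ φ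
  | allI {Γ : List Ty} {Δ : List (Fml Γ)} {σ : Ty} {φ : Fml (σ :: Γ)} :
      Prv (Δ.map (Fml.wk σ)) φ → Prv Δ (Fml.all σ φ)
  | allE {Γ : List Ty} {Δ : List (Fml Γ)} {σ : Ty} {φ : Fml (σ :: Γ)} (t : Tm Γ σ) :
      Prv Δ (Fml.all σ φ) → Prv Δ (φ.inst t)

/-- `RCA₀^ω` proves the sentence `φ`. -/
def Provable (φ : Fml []) : Prop := Prv [] φ

/-! ### Linear orders -/

section Orders

variable {Γ : List Ty}

/-- `X` is (the characteristic function of) a set: it is binary. -/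
def isSet (X : Tm Γ Ty.one) : Fml Γ :=
  Fml.all Ty.nat ((X.wk _ ⬝ x0 ≐ tzero).or (X.wk _ ⬝ x0 ≐ tone))

/-- `t ∈ X`, i.e. `X(t) = 1`. -/
def mem (t : Tm Γ Ty.nat) (X : Tm Γ Ty.one) : Fml Γ := X ⬝ t ≐ tone

/-- `i ≤_X j`, i.e. `(i, j) ∈ X`. -/
def leX (X : Tm Γ Ty.one) (i j : Tm Γ Ty.nat) : Fml Γ := mem (tpair i j) X

/-- `i <_X j`, i.e. `(i, j) ∈ X` and `(j, i) ∉ X`. -/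
def ltX (X : Tm Γ Ty.one) (i j : Tm Γ Ty.nat) : Fml Γ := (leX X i j).and (leX X j i).neg

/-- `i ∈ field(X)`, i.e. `(i, i) ∈ X`. -/
def fieldX (X : Tm Γ Ty.one) (i : Tm Γ Ty.nat) : Fml Γ := leX X i i

/-- `i < j` for numbers: `(∃ k) i + S k = j`. -/
def ltN (i j : Tm Γ Ty.nat) : Fml Γ := Fml.ex Ty.nat (tadd (i.wk _) (tsucc x0) ≐ j.wk _)

/-- `LO(X)`: the set `X` codes a reflexive relation which is transitive, antisymmetric and total on
its field. -/
def LO (X : Tm Γ Ty.one) : Fml Γ :=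
  (isSet X).and <|
  (Fml.all Ty.nat <| Fml.all Ty.nat <|
    leX ((X.wk _).wk _) x1 x0 ⊃ₑ
      (fieldX ((X.wk _).wk _) x1).and (fieldX ((X.wk _).wk _) x0)).and <|
  (Fml.all Ty.nat <| Fml.all Ty.nat <| Fml.all Ty.nat <|
    leX (((X.wk _).wk _).wk _) x2 x1 ⊃ₑ leX (((X.wk _).wk _).wk _) x1 x0 ⊃ₑ
      leX (((X.wk _).wk _).wk _) x2 x0).and <|
  (Fml.all Ty.nat <| Fml.all Ty.nat <|
    leX ((X.wk _).wk _) x1 x0 ⊃ₑ leX ((X.wk _).wk _) x0 x1 ⊃ₑ x1 ≐ x0).and <|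
  (Fml.all Ty.nat <| Fml.all Ty.nat <|
    fieldX ((X.wk _).wk _) x1 ⊃ₑ fieldX ((X.wk _).wk _) x0 ⊃ₑ
      (leX ((X.wk _).wk _) x1 x0).or (leX ((X.wk _).wk _) x0 x1))

/-- `LO_∞(X)`: `X` is a linear order whose field is not bounded by any number. -/
def LOinf (X : Tm Γ Ty.one) : Fml Γ :=
  (LO X).and <|
    Fml.all Ty.nat <| Fml.ex Ty.nat <| (fieldX ((X.wk _).wk _) x0).and (ltN x1 x0)

/-- The sequence `x` is ascending in `X`. -/
def ascending (X x : Tm Γ Ty.one) : Fml Γ :=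
  Fml.all Ty.nat (ltX (X.wk _) (x.wk _ ⬝ x0) (x.wk _ ⬝ tsucc x0))

/-- The sequence `x` is descending in `X`. -/
def descending (X x : Tm Γ Ty.one) : Fml Γ :=
  Fml.all Ty.nat (ltX (X.wk _) (x.wk _ ⬝ tsucc x0) (x.wk _ ⬝ x0))

end Orders

/-! ### The two principles, and explicit equivalence -/

/-- The matrix of `UADS`, with the functional `Ψ^{1 → 1}` as its free variable:
`(∀ X¹)[LO_∞(X) → Ψ(X) is ascending in X or descending in X]`. -/
def UADSmatrix : Fml [Ty.one ⟶ₜ Ty.one] :=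
  Fml.all Ty.one (LOinf x0 ⊃ₑ (ascending x0 (x1 ⬝ x0)).or (descending x0 (x1 ⬝ x0)))

/-- The matrix `MU(μ)` of `(μ²)`, with the functional `μ²` as its free variable:
`(∀ f¹)[(∃ n⁰) f(n) = 0 → f(μ(f)) = 0]`. -/
def MUmatrix : Fml [Ty.two] :=
  Fml.all Ty.one (Fml.ex Ty.nat (x1 ⬝ x0 ≐ tzero) ⊃ₑ x0 ⬝ (x1 ⬝ x0) ≐ tzero)

/-- `UADS` -/
def UADS : Fml [] := Fml.ex _ UADSmatrix

/-- `(μ²)` -/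
def muSquared : Fml [] := Fml.ex _ MUmatrix

/-- `RCA₀^ω` proves `(∀ Φ^ρ)[A(Φ) → B(t(Φ))]` for some closed term `t`. -/
def ExplicitImp {ρ τ : Ty} (A : Fml [ρ]) (B : Fml [τ]) : Prop :=
  ∃ t : Tm [] (ρ ⟶ₜ τ),
    Provable (Fml.all ρ (A ⊃ₑ
      B.subst (Sub.cons (t.ofClosed ⬝ x0) Sub.nil)))

end RCAω

namespace RCAω

/-! ### Substitution -/

/-! The main argument is not written as formal derivations. By a Henkin completeness theorem
(`provable_of_forall_model`) it suffices to verify each sentence in every model of the axioms. There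
one argues as in ordinary mathematics, except that induction is applied only to quantifier-free
formulas of the language.

From `Ψ` to `μ`: given `f`, call `n` late if `f` has a zero up to `n`, and early otherwise. Order
the early numbers as usual and put the late ones after them in reverse. A sequence descending in
this order starts at a late number, since otherwise it would be an infinite descent of early numbers
(`late_of_descending`). If `f` has a zero, no sequence ascends: it would have to become late and
then decrease forever as a sequence of numbers (`not_ascending`). Hence, if `f` has a zero, the
first value of `Ψ` at this order is late, and bounded search up to that value finds a zero.

From `μ` to `Ψ`: call an element of the field low if its predecessors are bounded, and high
otherwise. If the low elements are unbounded, every low element has a low one above it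
(`exists_low_gt`), which gives an ascending sequence. If they are bounded, every high element has a
high one below it (`exists_high_lt`), which gives a descending one. The functional `μ` decides
between the cases and selects the elements, and `R₀` iterates the selection. -/

def Sub.comp {Γ Δ Ξ : List Ty} (θ : Sub Γ Δ) (η : Sub Δ Ξ) : Sub Γ Ξ :=
  fun σ v => (θ σ v).subst η

@[ext] theorem Sub.ext {Γ Δ : List Ty} {θ η : Sub Γ Δ} (h : ∀ σ v, θ σ v = η σ v) : θ = η :=
  funext fun σ => funext fun v => h σ v

theorem Sub.ext_cons {Γ Δ : List Ty} {τ : Ty} {θ η : Sub (τ :: Γ) Δ}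
    (h0 : θ τ Var.zero = η τ Var.zero)
    (hs : ∀ σ (v : Var Γ σ), θ σ v.succ = η σ v.succ) : θ = η := by
  ext σ v
  cases v with
  | zero => exact h0
  | succ v => exact hs _ v

@[simp] theorem Tm.subst_var {Γ Δ : List Ty} (θ : Sub Γ Δ) {σ : Ty} (v : Var Γ σ) :
    (Tm.var v).subst θ = θ σ v := rfl
@[simp] theorem Tm.subst_cst {Γ Δ : List Ty} (θ : Sub Γ Δ) {σ : Ty} (c : Cst σ) :
    (Tm.cst c : Tm Γ σ).subst θ = Tm.cst c := rfl
@[simp] theorem Tm.subst_app {Γ Δ : List Ty} (θ : Sub Γ Δ) {σ τ : Ty} (s : Tm Γ (σ ⟶ₜ τ))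
    (t : Tm Γ σ) : (s ⬝ t).subst θ = s.subst θ ⬝ t.subst θ := rfl

@[simp] theorem Sub.cons_zero {Γ Δ : List Ty} {τ : Ty} (t : Tm Δ τ) (θ : Sub Γ Δ) :
    Sub.cons t θ τ Var.zero = t := rfl
@[simp] theorem Sub.cons_succ {Γ Δ : List Ty} {τ σ : Ty} (t : Tm Δ τ) (θ : Sub Γ Δ)
    (v : Var Γ σ) : Sub.cons t θ σ v.succ = θ σ v := rfl

theorem Tm.subst_subst {Γ Δ Ξ : List Ty} (θ : Sub Γ Δ) (η : Sub Δ Ξ) {σ : Ty} (t : Tm Γ σ) :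
    (t.subst θ).subst η = t.subst (θ.comp η) := by
  induction t with
  | var v => rfl
  | cst c => rfl
  | app s t ihs iht => simp [ihs, iht]

@[simp] theorem Tm.subst_id {Γ : List Ty} {σ : Ty} (t : Tm Γ σ) : t.subst (Sub.id Γ) = t := by
  induction t with
  | var v => rfl
  | cst c => rfl
  | app s t ihs iht => simp [ihs, iht]

theorem Tm.wk_subst_cons {Γ Δ : List Ty} {σ τ : Ty} (t : Tm Γ σ) (a : Tm Δ τ) (θ : Sub Γ Δ) :
    (t.wk τ).subst (Sub.cons a θ) = t.subst θ := Tm.subst_subst _ _ _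

theorem Tm.wk_subst_lift {Γ Δ : List Ty} {σ τ : Ty} (t : Tm Γ σ) (θ : Sub Γ Δ) :
    (t.wk τ).subst (θ.lift τ) = (t.subst θ).wk τ := by
  simp only [Tm.wk, Tm.subst_subst]
  rfl

theorem Sub.lift_id {Γ : List Ty} (τ : Ty) : (Sub.id Γ).lift τ = Sub.id (τ :: Γ) :=
  Sub.ext_cons rfl fun _ _ => rfl

theorem Sub.lift_comp {Γ Δ Ξ : List Ty} (τ : Ty) (θ : Sub Γ Δ) (η : Sub Δ Ξ) :
    (θ.lift τ).comp (η.lift τ) = (θ.comp η).lift τ :=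
  Sub.ext_cons rfl fun _ _ => Tm.wk_subst_lift _ _

theorem Sub.comp_assoc {Γ Δ Ξ Λ : List Ty} (θ : Sub Γ Δ) (η : Sub Δ Ξ) (ζ : Sub Ξ Λ) :
    (θ.comp η).comp ζ = θ.comp (η.comp ζ) :=
  Sub.ext fun _ _ => Tm.subst_subst _ _ _

theorem Sub.id_comp {Γ Δ : List Ty} (θ : Sub Γ Δ) : (Sub.id Γ).comp θ = θ := rfl

theorem Sub.comp_id {Γ Δ : List Ty} (θ : Sub Γ Δ) : θ.comp (Sub.id Δ) = θ :=
  Sub.ext fun _ _ => Tm.subst_id _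

theorem Sub.lift_comp_cons {Γ Δ Ξ : List Ty} {τ : Ty} (θ : Sub Γ Δ) (a : Tm Ξ τ) (η : Sub Δ Ξ) :
    (θ.lift τ).comp (Sub.cons a η) = Sub.cons a (θ.comp η) :=
  Sub.ext_cons rfl fun _ _ => Tm.wk_subst_cons _ _ _

theorem Sub.cons_comp {Γ Δ Ξ : List Ty} {τ : Ty} (t : Tm Δ τ) (θ : Sub Γ Δ) (η : Sub Δ Ξ) :
    (Sub.cons t θ).comp η = Sub.cons (t.subst η) (θ.comp η) :=
  Sub.ext_cons rfl fun _ _ => rfl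

theorem Fml.subst_subst {Γ Δ Ξ : List Ty} (θ : Sub Γ Δ) (η : Sub Δ Ξ) (φ : Fml Γ) :
    (φ.subst θ).subst η = φ.subst (θ.comp η) := by
  induction φ generalizing Δ Ξ with
  | eq s t => simp [Fml.subst, Tm.subst_subst]
  | fls => rfl
  | imp φ ψ ih1 ih2 => simp [Fml.subst, ih1, ih2]
  | all σ φ ih => simp [Fml.subst, ih, Sub.lift_comp]

@[simp] theorem Fml.subst_id {Γ : List Ty} (φ : Fml Γ) : φ.subst (Sub.id Γ) = φ := by
  induction φ with
  | eq s t => simp [Fml.subst]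
  | fls => rfl
  | imp φ ψ ih1 ih2 => simp [Fml.subst, ih1, ih2]
  | all σ φ ih => simp [Fml.subst, ih, Sub.lift_id]

theorem Fml.inst_subst {Γ Δ : List Ty} {σ : Ty} (φ : Fml (σ :: Γ)) (t : Tm Γ σ) (θ : Sub Γ Δ) :
    (φ.inst t).subst θ = (φ.subst (θ.lift σ)).inst (t.subst θ) := by
  simp only [Fml.inst, Fml.subst_subst, Sub.cons_comp, Sub.lift_comp_cons, Sub.id_comp,
    Sub.comp_id]

theorem Fml.wk_subst_lift {Γ Δ : List Ty} {τ : Ty} (φ : Fml Γ) (θ : Sub Γ Δ) :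
    (φ.wk τ).subst (θ.lift τ) = (φ.subst θ).wk τ := by
  simp only [Fml.wk, Fml.subst_subst]
  rfl

theorem Fml.eqT_subst {Γ Δ : List Ty} (θ : Sub Γ Δ) (ρ : Ty) (s t : Tm Γ ρ) :
    (Fml.eqT ρ s t).subst θ = Fml.eqT ρ (s.subst θ) (t.subst θ) := by
  induction ρ generalizing Γ Δ with
  | nat => rfl
  | arr σ τ _ ih =>
    simp only [Fml.eqT, Fml.subst, ih, Tm.subst_app, Tm.wk_subst_lift]
    rfl

theorem Fml.QF.subst {Γ Δ : List Ty} (θ : Sub Γ Δ) {φ : Fml Γ} (h : φ.QF) : (φ.subst θ).QF := by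
  induction h generalizing Δ with
  | eq s t => exact .eq _ _
  | fls => exact .fls
  | imp _ _ ih1 ih2 => exact .imp (ih1 θ) (ih2 θ)

/-- The schemes allow arbitrary terms and parameters, so instances go to instances. For `ind` and
`choice` the point is that `θ` commutes with the substitutions built into the schemes. -/
theorem Ax.subst {Γ Δ : List Ty} (θ : Sub Γ Δ) {φ : Fml Γ} (h : Ax φ) : Ax (φ.subst θ) := by
  cases h with
  | refl s => exact .refl _
  | symm s t => exact .symm _ _
  | trans s t r => exact .trans _ _ _
  | succ_ne_zero s => exact .succ_ne_zero _
  | succ_inj s t => exact .succ_inj _ _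
  | proj a b => rw [Fml.eqT_subst]; exact .proj _ _
  | comb a b c => rw [Fml.eqT_subst]; exact .comb _ _ _
  | rec_zero a b => exact .rec_zero _ _
  | rec_succ n a b => exact .rec_succ _ _ _
  | ext f a b =>
    simp only [Fml.subst, Fml.eqT_subst]
    exact .ext _ _ _
  | ind φ hφ =>
    have := Ax.ind (φ.subst (θ.lift _)) (hφ.subst _)
    have e : (Sub.cons (tsucc x0) (Sub.wk Ty.nat)).comp (θ.lift Ty.nat) =
        (θ.lift Ty.nat).comp (Sub.cons (tsucc x0) (Sub.wk Ty.nat)) := by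
      rw [Sub.cons_comp, Sub.lift_comp_cons]
      rfl
    simpa only [Fml.subst, Fml.inst_subst, Fml.subst_subst, e, Tm.subst_cst] using this
  | choice φ hφ =>
    have e : (Sub.cons (x1 ⬝ x0) (Sub.cons x0 fun _ v => Tm.var v.succ.succ)).comp
          ((θ.lift Ty.two).lift Ty.one) =
        ((θ.lift Ty.one).lift Ty.nat).comp
          (Sub.cons (x1 ⬝ x0) (Sub.cons x0 fun _ v => Tm.var v.succ.succ)) := by
      rw [Sub.cons_comp, Sub.lift_comp_cons, Sub.cons_comp, Sub.lift_comp_cons]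
      refine congrArg _ (congrArg _ (Sub.ext fun σ v => ?_))
      simp only [Sub.comp, Sub.lift, Tm.subst_var, Sub.cons_succ, Tm.wk, Tm.subst_subst]
      rfl
    have := Ax.choice (φ.subst ((θ.lift _).lift _)) (hφ.subst _)
    rw [Fml.subst_subst, ← e] at this
    simpa only [Fml.subst, Fml.subst_subst] using this

/-- Weakening of contexts, weakening of assumptions and passage along a chain of theories are all
special cases; hence the freedom in `Δ'`. -/
theorem Prv.subst {Γ Γ' : List Ty} {Δ : List (Fml Γ)} {φ : Fml Γ} (h : Prv Δ φ) (θ : Sub Γ Γ')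
    {Δ' : List (Fml Γ')} (hΔ : ∀ δ ∈ Δ, δ.subst θ ∈ Δ') : Prv Δ' (φ.subst θ) := by
  induction h generalizing Γ' with
  | ax h => exact .ax (h.subst θ)
  | hyp h => exact .hyp (hΔ _ h)
  | impI _ ih =>
    refine .impI (ih θ fun δ hδ => ?_)
    rcases List.mem_cons.1 hδ with rfl | hδ
    · exact List.mem_cons_self
    · exact List.mem_cons_of_mem _ (hΔ _ hδ)
  | impE _ _ ih1 ih2 => exact .impE (ih1 θ hΔ) (ih2 θ hΔ)
  | raa _ ih =>
    refine .raa (ih θ fun δ hδ => ?_)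
    rcases List.mem_cons.1 hδ with rfl | hδ
    · exact List.mem_cons_self
    · exact List.mem_cons_of_mem _ (hΔ _ hδ)
  | allI _ ih =>
    refine .allI (ih (θ.lift _) fun δ hδ => ?_)
    obtain ⟨δ', h', rfl⟩ := List.mem_map.1 hδ
    rw [Fml.wk_subst_lift]
    exact List.mem_map_of_mem (hΔ _ h')
  | allE t _ ih =>
    rw [Fml.inst_subst]
    exact .allE _ (ih θ hΔ)

theorem Prv.mono {Γ : List Ty} {Δ Δ' : List (Fml Γ)} {φ : Fml Γ} (h : Prv Δ φ) (hΔ : Δ ⊆ Δ') :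
    Prv Δ' φ := by
  simpa using h.subst (Sub.id Γ) (Δ' := Δ') (by simpa using fun δ hδ => hΔ hδ)

/-- Instantiating a universally quantified formula after a substitution. -/
theorem Prv.allE_subst {Γ Γ' : List Ty} {Δ : List (Fml Γ')} {σ : Ty} {φ : Fml (σ :: Γ)}
    {θ : Sub Γ Γ'} (h : Prv Δ ((Fml.all σ φ).subst θ)) (t : Tm Γ' σ) :
    Prv Δ (φ.subst (Sub.cons t θ)) := by
  have := Prv.allE t h
  rwa [Fml.inst, Fml.subst_subst, Sub.lift_comp_cons, Sub.comp_id] at this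

theorem Prv.byCases {Γ : List Ty} {Δ : List (Fml Γ)} {φ : Fml Γ}
    (h1 : Prv (φ :: Δ) Fml.fls) (h2 : Prv (φ.neg :: Δ) Fml.fls) : Prv Δ Fml.fls :=
  .impE (.impI h1) (.raa h2)

theorem Prv.exfalso {Γ : List Ty} {Δ : List (Fml Γ)} {φ : Fml Γ} (h : Prv Δ Fml.fls) : Prv Δ φ :=
  .raa (h.mono (List.subset_cons_self _ _))

/-! ### Derived rules -/

/-- Converse of `allI`. It reduces the laws of higher-type equality to type `0` by induction on the
type. -/
theorem Prv.allE_var {Γ : List Ty} {Δ : List (Fml Γ)} {σ : Ty} {φ : Fml (σ :: Γ)}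
    (h : Prv Δ (Fml.all σ φ)) : Prv (Δ.map (Fml.wk σ)) φ := by
  have h' := (h.subst (Sub.wk σ) (Δ' := Δ.map (Fml.wk σ))
    (fun δ hδ => List.mem_map_of_mem hδ)).allE_subst x0
  have e : Sub.cons x0 (Sub.wk σ) = Sub.id (σ :: Γ) := Sub.ext_cons rfl fun _ _ => rfl
  rwa [e, Fml.subst_id] at h'

theorem Prv.eqT_refl {Γ : List Ty} (Δ : List (Fml Γ)) (ρ : Ty) (s : Tm Γ ρ) :
    Prv Δ (Fml.eqT ρ s s) := by
  induction ρ generalizing Γ with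
  | nat => exact .ax (.refl s)
  | arr σ τ _ ih => exact .allI (ih _ _)

theorem Prv.eqT_symm {Γ : List Ty} {Δ : List (Fml Γ)} {ρ : Ty} {s t : Tm Γ ρ}
    (h : Prv Δ (Fml.eqT ρ s t)) : Prv Δ (Fml.eqT ρ t s) := by
  induction ρ generalizing Γ with
  | nat => exact .impE (.ax (.symm s t)) h
  | arr σ τ _ ih => exact .allI (ih (Prv.allE_var h))

theorem Prv.eqT_trans {Γ : List Ty} {Δ : List (Fml Γ)} {ρ : Ty} {s t r : Tm Γ ρ}
    (h : Prv Δ (Fml.eqT ρ s t)) (h' : Prv Δ (Fml.eqT ρ t r)) : Prv Δ (Fml.eqT ρ s r) := by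
  induction ρ generalizing Γ with
  | nat => exact .impE (.impE (.ax (.trans s t r)) h) h'
  | arr σ τ _ ih => exact .allI (ih (Prv.allE_var h) (Prv.allE_var h'))

/-- The extensionality axiom replaces the argument, and pointwise equality replaces the function.
This makes application well defined in the term model. -/
theorem Prv.eqT_app {Γ : List Ty} {Δ : List (Fml Γ)} {σ τ : Ty} {f g : Tm Γ (σ ⟶ₜ τ)}
    {s t : Tm Γ σ} (h : Prv Δ (Fml.eqT _ f g)) (h' : Prv Δ (Fml.eqT _ s t)) :
    Prv Δ (Fml.eqT τ (f ⬝ s) (g ⬝ t)) := by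
  refine Prv.eqT_trans (.impE (.ax (.ext f s t)) h') ?_
  have := Prv.allE t h
  simpa only [Fml.inst, Fml.eqT_subst, Tm.subst_app, Tm.wk_subst_cons, Tm.subst_id,
    Tm.subst_var, Sub.cons_zero] using this

/-! ### Structures -/

/-- An extensional typed structure interpreting the constants. -/
structure TyStr where
  D : Ty → Type
  app : ∀ {σ τ : Ty}, D (σ ⟶ₜ τ) → D σ → D τ
  cst : ∀ {σ : Ty}, Cst σ → D σ
  ext : ∀ {σ τ : Ty} {f g : D (σ ⟶ₜ τ)}, (∀ x, app f x = app g x) → f = g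

abbrev TyStr.Env (M : TyStr) (Γ : List Ty) : Type := ∀ σ : Ty, Var Γ σ → M.D σ

def TyStr.Env.nil {M : TyStr} : M.Env [] := nofun

def TyStr.Env.cons {M : TyStr} {Γ : List Ty} {τ : Ty} (d : M.D τ) (ρ : M.Env Γ) : M.Env (τ :: Γ)
  | _, .zero => d
  | _, .succ v => ρ _ v

variable {M : TyStr}

@[simp] theorem TyStr.Env.cons_zero {Γ : List Ty} {τ : Ty} (d : M.D τ) (ρ : M.Env Γ) :
    ρ.cons d τ Var.zero = d := rfl
@[simp] theorem TyStr.Env.cons_succ {Γ : List Ty} {τ σ : Ty} (d : M.D τ) (ρ : M.Env Γ)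
    (v : Var Γ σ) : ρ.cons d σ v.succ = ρ σ v := rfl

theorem TyStr.Env.ext_cons {Γ : List Ty} {τ : Ty} {ρ η : M.Env (τ :: Γ)}
    (h0 : ρ τ Var.zero = η τ Var.zero)
    (hs : ∀ σ (v : Var Γ σ), ρ σ v.succ = η σ v.succ) : ρ = η := by
  funext σ v
  cases v with
  | zero => exact h0
  | succ v => exact hs _ v

theorem TyStr.Env.ext_nil (ρ η : M.Env []) : ρ = η := by
  funext σ v
  cases v

def TyStr.eval (M : TyStr) {Γ : List Ty} (ρ : M.Env Γ) : {σ : Ty} → Tm Γ σ → M.D σ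
  | _, .var v => ρ _ v
  | _, .cst c => M.cst c
  | _, .app s t => M.app (M.eval ρ s) (M.eval ρ t)

@[simp] theorem TyStr.eval_var {Γ : List Ty} (ρ : M.Env Γ) {σ : Ty} (v : Var Γ σ) :
    M.eval ρ (.var v) = ρ σ v := rfl
@[simp] theorem TyStr.eval_cst {Γ : List Ty} (ρ : M.Env Γ) {σ : Ty} (c : Cst σ) :
    M.eval ρ (.cst c) = M.cst c := rfl
@[simp] theorem TyStr.eval_app {Γ : List Ty} (ρ : M.Env Γ) {σ τ : Ty} (s : Tm Γ (σ ⟶ₜ τ))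
    (t : Tm Γ σ) : M.eval ρ (s ⬝ t) = M.app (M.eval ρ s) (M.eval ρ t) := rfl

def TyStr.Sat (M : TyStr) : {Γ : List Ty} → M.Env Γ → Fml Γ → Prop
  | _, ρ, .eq s t => M.eval ρ s = M.eval ρ t
  | _, _, .fls => False
  | _, ρ, .imp φ ψ => M.Sat ρ φ → M.Sat ρ ψ
  | _, ρ, .all σ φ => ∀ d : M.D σ, M.Sat (ρ.cons d) φ

theorem TyStr.eval_subst {Γ Δ : List Ty} (ρ : M.Env Δ) (θ : Sub Γ Δ) {σ : Ty} (t : Tm Γ σ) :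
    M.eval ρ (t.subst θ) = M.eval (fun σ v => M.eval ρ (θ σ v)) t := by
  induction t with
  | var v => rfl
  | cst c => rfl
  | app s t ihs iht => simp [ihs, iht]

@[simp] theorem TyStr.eval_wk {Γ : List Ty} (ρ : M.Env Γ) {σ τ : Ty} (d : M.D τ) (t : Tm Γ σ) :
    M.eval (ρ.cons d) (t.wk τ) = M.eval ρ t := M.eval_subst _ _ t

@[simp] theorem TyStr.eval_ofClosed {Γ : List Ty} (ρ : M.Env Γ) {σ : Ty} (t : Tm [] σ) :
    M.eval ρ t.ofClosed = M.eval Env.nil t := by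
  rw [Tm.ofClosed, TyStr.eval_subst]
  congr 1
  exact Env.ext_nil _ _

theorem TyStr.sat_subst {Γ Δ : List Ty} (ρ : M.Env Δ) (θ : Sub Γ Δ) (φ : Fml Γ) :
    M.Sat ρ (φ.subst θ) ↔ M.Sat (fun σ v => M.eval ρ (θ σ v)) φ := by
  induction φ generalizing Δ with
  | eq s t => simp [Fml.subst, TyStr.Sat, TyStr.eval_subst]
  | fls => rfl
  | imp φ ψ ih1 ih2 => simp [Fml.subst, TyStr.Sat, ih1, ih2]
  | all σ φ ih =>
    simp only [Fml.subst, TyStr.Sat, ih]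
    refine forall_congr' fun d => iff_of_eq (congrArg (fun η => M.Sat η φ) ?_)
    exact Env.ext_cons rfl fun _ _ => M.eval_wk _ _ _

section
variable {Γ : List Ty} (ρ : M.Env Γ)

@[simp] theorem TyStr.sat_eq (s t : Tm Γ Ty.nat) :
    M.Sat ρ (s ≐ t) ↔ M.eval ρ s = M.eval ρ t := Iff.rfl
@[simp] theorem TyStr.sat_fls : M.Sat ρ Fml.fls ↔ False := Iff.rfl
@[simp] theorem TyStr.sat_imp (φ ψ : Fml Γ) :
    M.Sat ρ (φ ⊃ₑ ψ) ↔ (M.Sat ρ φ → M.Sat ρ ψ) := Iff.rfl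
@[simp] theorem TyStr.sat_all (σ : Ty) (φ : Fml (σ :: Γ)) :
    M.Sat ρ (Fml.all σ φ) ↔ ∀ d : M.D σ, M.Sat (ρ.cons d) φ := Iff.rfl
theorem TyStr.sat_and (φ ψ : Fml Γ) :
    M.Sat ρ (φ.and ψ) ↔ (M.Sat ρ φ ∧ M.Sat ρ ψ) := by simp
theorem TyStr.sat_or (φ ψ : Fml Γ) :
    M.Sat ρ (φ.or ψ) ↔ (M.Sat ρ φ ∨ M.Sat ρ ψ) := by simp; tauto
theorem TyStr.sat_ex (σ : Ty) (φ : Fml (σ :: Γ)) :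
    M.Sat ρ (Fml.ex σ φ) ↔ ∃ d : M.D σ, M.Sat (ρ.cons d) φ := by simp
end

/-- Extensionality of the structure turns the defined equality into identity, so that in a model the
combinator axioms can be used for rewriting. -/
theorem TyStr.sat_eqT {Γ : List Ty} (σ : Ty) (ρ : M.Env Γ) (s t : Tm Γ σ) :
    M.Sat ρ (Fml.eqT σ s t) ↔ M.eval ρ s = M.eval ρ t := by
  induction σ generalizing Γ with
  | nat => rfl
  | arr σ τ _ ih =>
    simp only [Fml.eqT, TyStr.sat_all, ih, TyStr.eval_app, TyStr.eval_wk, TyStr.eval_var,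
      Env.cons_zero]
    exact ⟨M.ext, fun h _ => by rw [h]⟩

/-- A model of `RCA₀^ω`. -/
structure Model extends TyStr where
  models : ∀ {Γ : List Ty} {φ : Fml Γ}, Ax φ → ∀ ρ : toTyStr.Env Γ, toTyStr.Sat ρ φ

/-! ### Witnessed complete extensions -/

deriving instance Countable for Ty
deriving instance Countable for Var
deriving instance Countable for Cst
deriving instance Countable for Tm
deriving instance Countable for Fml

theorem exists_enum (Γ : List Ty) : ∃ e : ℕ → Fml Γ, Function.Surjective e :=
  haveI : Nonempty (Fml Γ) := ⟨Fml.fls⟩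
  exists_surjective_nat _

/-- One step of the construction: decide `ψ`, and add a counterexample if `ψ` is a universal
formula that has been refuted. -/
theorem exists_decide {Γ : List Ty} {Δ : List (Fml Γ)} (hΔ : ¬ Prv Δ Fml.fls) (ψ : Fml Γ) :
    ∃ (τ : Ty) (Δ' : List (Fml (τ :: Γ))), ¬ Prv Δ' Fml.fls ∧ (∀ δ ∈ Δ, δ.wk τ ∈ Δ') ∧
      (ψ.wk τ ∈ Δ' ∨ ψ.neg.wk τ ∈ Δ') ∧
      ∀ σ χ, ψ = Fml.all σ χ →
        ψ.wk τ ∈ Δ' ∨ ∃ t, (χ.subst (Sub.cons t (Sub.wk τ))).neg ∈ Δ' := by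
  -- A dummy variable of type `0` does not affect consistency, because zero can be substituted for
  -- it.
  have key : ∀ {Δ : List (Fml Γ)}, ¬ Prv Δ Fml.fls →
      ¬ Prv (Δ.map (Fml.wk Ty.nat)) (Fml.fls : Fml (Ty.nat :: Γ)) :=
    fun hΔ h => hΔ (Prv.allE tzero (Prv.allI h))
  by_cases h : Prv (ψ :: Δ) Fml.fls
  · have h2 : ¬ Prv (ψ.neg :: Δ) Fml.fls := fun h2 => hΔ (h.byCases h2)
    by_cases hψ : ∃ σ χ, ψ = Fml.all σ χ
    · obtain ⟨σ, χ, rfl⟩ := hψ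
      -- The fresh variable is itself the counterexample. Were this inconsistent, `χ` would be
      -- derivable for a fresh variable, hence universally, against its refutation.
      refine ⟨σ, χ.neg :: ((Fml.all σ χ).neg :: Δ).map (Fml.wk σ), fun h3 => h2 ?_, ?_, ?_, ?_⟩
      · exact .impE (.hyp List.mem_cons_self) (.allI (.raa h3))
      · exact fun δ hδ => List.mem_cons_of_mem _
          (List.mem_map_of_mem (List.mem_cons_of_mem _ hδ))
      · simp
      · rintro σ' χ' ⟨⟩
        refine .inr ⟨x0, ?_⟩
        have e : Sub.cons x0 (Sub.wk σ) = Sub.id (σ :: Γ) := Sub.ext_cons rfl fun _ _ => rfl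
        simp [e]
    · refine ⟨Ty.nat, (ψ.neg :: Δ).map (Fml.wk _), key h2, fun δ hδ =>
      List.mem_map_of_mem (List.mem_cons_of_mem _ hδ), by simp, ?_⟩
      exact fun σ χ e => absurd ⟨σ, χ, e⟩ hψ
  · exact ⟨Ty.nat, (ψ :: Δ).map (Fml.wk _), key h, fun δ hδ =>
      List.mem_map_of_mem (List.mem_cons_of_mem _ hδ), by simp,
      fun _ _ _ => by simp⟩

/-- A consistent finite theory, with a list of formulas still to be decided. -/
structure Stage where
  Γ : List Ty
  Δ : List (Fml Γ)
  cons : ¬ Prv Δ Fml.fls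
  pend : ℕ → ℕ → Fml Γ

/-- Row `i` of `pend` lists all formulas over the context of stage `i`, transported to the current
context. Step `n` treats the entry coded by `n`, whose row is at most `n` and so already filled, and
then fills row `n + 1` for the new context. Thus every formula of every stage is treated eventually.
-/
theorem Stage.exists_next (n : ℕ) (S : Stage) :
    ∃ S' : Stage, ∃ w : Sub S.Γ S'.Γ, (∀ δ ∈ S.Δ, δ.subst w ∈ S'.Δ) ∧
      ((S.pend n.unpair.1 n.unpair.2).subst w ∈ S'.Δ ∨
        (S.pend n.unpair.1 n.unpair.2).neg.subst w ∈ S'.Δ) ∧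
      (∀ σ χ, S.pend n.unpair.1 n.unpair.2 = Fml.all σ χ →
        (S.pend n.unpair.1 n.unpair.2).subst w ∈ S'.Δ ∨
          ∃ t, (χ.subst (Sub.cons t w)).neg ∈ S'.Δ) ∧
      (∀ i ≤ n, ∀ j, S'.pend i j = (S.pend i j).subst w) ∧
      Function.Surjective (S'.pend (n + 1)) := by
  obtain ⟨τ, Δ', h1, h2, h3, h4⟩ := exists_decide S.cons (S.pend n.unpair.1 n.unpair.2)
  obtain ⟨e, he⟩ := exists_enum (τ :: S.Γ)
  refine ⟨⟨τ :: S.Γ, Δ', h1, fun i j => if i ≤ n then (S.pend i j).wk τ else e j⟩, Sub.wk τ,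
    h2, h3, h4, fun i hi j => by simp [hi, Fml.wk], by simpa using he⟩

/-- A chain of consistent finite theories in growing contexts which decides every formula and has
a counterexample for every refuted universal formula. -/
structure Chain where
  Γ : ℕ → List Ty
  Δ : ∀ n, List (Fml (Γ n))
  cons : ∀ n, ¬ Prv (Δ n) Fml.fls
  w : ∀ n, Sub (Γ n) (Γ (n + 1))
  mem_succ : ∀ n, ∀ δ ∈ Δ n, δ.subst (w n) ∈ Δ (n + 1)
  up : ∀ {m n : ℕ}, m ≤ n → Sub (Γ m) (Γ n)
  up_self : ∀ n, up (le_refl n) = Sub.id (Γ n)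
  up_succ : ∀ {m n : ℕ} (h : m ≤ n), up (h.trans n.le_succ) = (up h).comp (w n)
  decide : ∀ n (ψ : Fml (Γ n)), ∃ m, ∃ h : n ≤ m,
    ψ.subst (up h) ∈ Δ m ∨ ψ.neg.subst (up h) ∈ Δ m
  witness : ∀ n σ (χ : Fml (σ :: Γ n)), ∃ m, ∃ h : n ≤ m,
    (Fml.all σ χ).subst (up h) ∈ Δ m ∨ ∃ t, (χ.subst (Sub.cons t (up h))).neg ∈ Δ m

theorem exists_chain {Δ : List (Fml [])} (hΔ : ¬ Prv Δ Fml.fls) :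
    ∃ (C : Chain) (θ : Sub [] (C.Γ 0)), ∀ δ ∈ Δ, δ.subst θ ∈ C.Δ 0 := by
  obtain ⟨e, he⟩ := exists_enum []
  choose next w h1 h2 h3 h4 h5 using Stage.exists_next
  let st : ℕ → Stage := fun n => Nat.rec ⟨[], Δ, hΔ, fun _ => e⟩ next n
  let up : ∀ {m n : ℕ}, m ≤ n → Sub (st m).Γ (st n).Γ := fun {m n} h =>
    Nat.leRecOn (C := fun n => Sub (st m).Γ (st n).Γ) h
      (fun {k} θ => θ.comp (w k (st k))) (Sub.id _)
  have up_self : ∀ n, up (le_refl n) = Sub.id (st n).Γ := fun n => Nat.leRecOn_self _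
  have up_succ : ∀ {m n : ℕ} (h : m ≤ n),
      up (h.trans n.le_succ) = (up h).comp (w n (st n)) := fun h => Nat.leRecOn_succ h _
  have hsurj : ∀ n, Function.Surjective ((st n).pend n) := by
    intro n
    cases n with
    | zero => exact he
    | succ n => exact h5 n (st n)
  have hpend : ∀ {m n : ℕ} (h : m ≤ n) (j : ℕ),
      (st n).pend m j = ((st m).pend m j).subst (up h) := by
    intro m n h j
    induction n, h using Nat.le_induction with
    | base => simp [up_self]
    | succ n h ih =>
      rw [up_succ h, ← Fml.subst_subst, ← ih]
      exact h4 n (st n) m h j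
  refine ⟨⟨fun n => (st n).Γ, fun n => (st n).Δ, fun n => (st n).cons, fun n => w n (st n),
    fun n => h1 n (st n), up, up_self, up_succ, ?_, ?_⟩, Sub.id [],
    fun δ hδ => by simpa [st] using hδ⟩
  · intro n ψ
    obtain ⟨j, rfl⟩ := hsurj n ψ
    -- The formula is entry `(n, j)`, treated in step `Nat.pair n j`, when row `n` is already
    -- filled.
    have hn : n ≤ Nat.pair n j := Nat.left_le_pair n j
    refine ⟨Nat.pair n j + 1, hn.trans (Nat.le_succ _), ?_⟩
    have := h2 (Nat.pair n j) (st (Nat.pair n j))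
    simp only [Nat.unpair_pair] at this
    rw [hpend hn] at this
    rw [up_succ hn]
    simpa only [Fml.subst, Fml.subst_subst] using this
  · intro n σ χ
    obtain ⟨j, hj⟩ := hsurj n (Fml.all σ χ)
    have hn : n ≤ Nat.pair n j := Nat.left_le_pair n j
    refine ⟨Nat.pair n j + 1, hn.trans (Nat.le_succ _), ?_⟩
    have := h3 (Nat.pair n j) (st (Nat.pair n j))
    simp only [Nat.unpair_pair] at this
    rw [hpend hn, hj] at this
    have := this _ _ rfl
    rw [up_succ hn]
    simpa only [Fml.subst_subst, Sub.lift_comp_cons] using this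

/-! ### The limit theory of a chain -/

namespace Chain

variable (C : Chain)

theorem up_trans {l m n : ℕ} (h : l ≤ m) (h' : m ≤ n) :
    (C.up h).comp (C.up h') = C.up (h.trans h') := by
  induction n, h' using Nat.le_induction with
  | base => rw [C.up_self, Sub.comp_id]
  | succ n h' ih => rw [C.up_succ h', ← Sub.comp_assoc, ih, C.up_succ (h.trans h')]

theorem mem_up {m n : ℕ} (h : m ≤ n) {δ : Fml (C.Γ m)} (hδ : δ ∈ C.Δ m) :
    δ.subst (C.up h) ∈ C.Δ n := by
  induction n, h using Nat.le_induction with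
  | base => rwa [C.up_self, Fml.subst_id]
  | succ n h ih =>
    rw [C.up_succ h, ← Fml.subst_subst]
    exact C.mem_succ _ _ ih

theorem prv_up {m n : ℕ} (h : m ≤ n) {φ : Fml (C.Γ m)} (hφ : Prv (C.Δ m) φ) :
    Prv (C.Δ n) (φ.subst (C.up h)) := hφ.subst _ fun _ => C.mem_up h

/-- The formula `φ` belongs to the limit theory. -/
def T (n : ℕ) (φ : Fml (C.Γ n)) : Prop :=
  ∃ m, ∃ h : n ≤ m, Prv (C.Δ m) (φ.subst (C.up h))

variable {C}

theorem T_of_prv {n : ℕ} {φ : Fml (C.Γ n)} (h : Prv (C.Δ n) φ) : C.T n φ :=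
  ⟨n, le_rfl, by rwa [C.up_self, Fml.subst_id]⟩

theorem T_up {m n : ℕ} (h : m ≤ n) {φ : Fml (C.Γ m)} :
    C.T n (φ.subst (C.up h)) ↔ C.T m φ := by
  constructor
  · rintro ⟨k, hk, hφ⟩
    exact ⟨k, h.trans hk, by rwa [Fml.subst_subst, C.up_trans] at hφ⟩
  · rintro ⟨k, hk, hφ⟩
    refine ⟨max k n, le_max_right _ _, ?_⟩
    have := C.prv_up (le_max_left k n) hφ
    rwa [Fml.subst_subst, C.up_trans] at this ⊢

theorem T.prv_two {n : ℕ} {φ ψ : Fml (C.Γ n)} (hφ : C.T n φ) (hψ : C.T n ψ) :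
    ∃ m, ∃ h : n ≤ m, Prv (C.Δ m) (φ.subst (C.up h)) ∧ Prv (C.Δ m) (ψ.subst (C.up h)) := by
  obtain ⟨k, hk, hφ⟩ := hφ
  obtain ⟨l, hl, hψ⟩ := hψ
  refine ⟨max k l, hk.trans (le_max_left _ _), ?_, ?_⟩
  · simpa only [Fml.subst_subst, C.up_trans] using C.prv_up (le_max_left k l) hφ
  · simpa only [Fml.subst_subst, C.up_trans] using C.prv_up (le_max_right k l) hψ

theorem T.mp {n : ℕ} {φ ψ : Fml (C.Γ n)} (h : C.T n (φ ⊃ₑ ψ)) (hφ : C.T n φ) : C.T n ψ := by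
  obtain ⟨m, hm, h1, h2⟩ := h.prv_two hφ
  exact ⟨m, hm, h1.impE h2⟩

theorem not_T_fls {n : ℕ} : ¬ C.T n Fml.fls := fun ⟨m, _, h⟩ => C.cons m h

theorem T_or_T_neg (n : ℕ) (φ : Fml (C.Γ n)) : C.T n φ ∨ C.T n φ.neg := by
  obtain ⟨m, h, h' | h'⟩ := C.decide n φ
  · exact .inl ⟨m, h, .hyp h'⟩
  · exact .inr ⟨m, h, .hyp h'⟩

/-- One direction is modus ponens; the other needs that the limit theory decides `φ`. -/
theorem T_imp {n : ℕ} {φ ψ : Fml (C.Γ n)} : C.T n (φ ⊃ₑ ψ) ↔ (C.T n φ → C.T n ψ) := by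
  refine ⟨T.mp, fun h => ?_⟩
  rcases T_or_T_neg n φ with hφ | ⟨m, hm, hφ⟩
  · obtain ⟨m, hm, hψ⟩ := h hφ
    exact ⟨m, hm, .impI (hψ.mono (List.subset_cons_self _ _))⟩
  · exact ⟨m, hm, .impI (Prv.exfalso (.impE (hφ.mono (List.subset_cons_self _ _))
      (.hyp List.mem_cons_self)))⟩

/-- The terms of all later stages are needed, since they name the elements of the model. Conversely,
if the universal formula were refuted, the counterexample added along the chain would contradict the
assumption. -/
theorem T_all {n : ℕ} {σ : Ty} {χ : Fml (σ :: C.Γ n)} :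
    C.T n (Fml.all σ χ) ↔
      ∀ m (h : n ≤ m) (t : Tm (C.Γ m) σ), C.T m (χ.subst (Sub.cons t (C.up h))) := by
  constructor
  · intro hχ m h t
    obtain ⟨k, hk, hχ⟩ := (T_up h).2 hχ
    refine ⟨k, hk, ?_⟩
    rw [Fml.subst_subst, C.up_trans] at hχ
    simpa only [Fml.subst_subst, Sub.cons_comp, C.up_trans] using
      hχ.allE_subst (t.subst (C.up hk))
  · intro hχ
    obtain ⟨m, h, h' | ⟨t, h'⟩⟩ := C.witness n σ χ
    · exact ⟨m, h, .hyp h'⟩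
    · exact (not_T_fls ((T_of_prv (.hyp h')).mp (hχ m h t))).elim

/-! ### The term model -/

def Rel {σ : Ty} (a b : Σ n, Tm (C.Γ n) σ) : Prop :=
  ∃ m, ∃ (h : a.1 ≤ m) (h' : b.1 ≤ m),
    Prv (C.Δ m) (Fml.eqT σ (a.2.subst (C.up h)) (b.2.subst (C.up h')))

theorem Rel.lift {σ : Ty} {a b : Σ n, Tm (C.Γ n) σ} (h : Rel a b) :
    ∃ m, ∀ k, m ≤ k → ∃ (h : a.1 ≤ k) (h' : b.1 ≤ k),
      Prv (C.Δ k) (Fml.eqT σ (a.2.subst (C.up h)) (b.2.subst (C.up h'))) := by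
  obtain ⟨m, h, h', hp⟩ := h
  refine ⟨m, fun k hk => ⟨h.trans hk, h'.trans hk, ?_⟩⟩
  simpa only [Fml.eqT_subst, Tm.subst_subst, C.up_trans] using C.prv_up hk hp

variable (C) in
def setoid (σ : Ty) : Setoid (Σ n, Tm (C.Γ n) σ) where
  r := Rel
  iseqv := by
    refine ⟨fun a => ⟨a.1, le_rfl, le_rfl, Prv.eqT_refl _ _ _⟩, ?_, ?_⟩
    · rintro a b ⟨m, h, h', hp⟩
      exact ⟨m, h', h, hp.eqT_symm⟩
    · intro a b c hab hbc
      obtain ⟨m, hm⟩ := hab.lift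
      obtain ⟨n, hn⟩ := hbc.lift
      obtain ⟨h1, h2, hp⟩ := hm _ (le_max_left m n)
      obtain ⟨h3, h4, hq⟩ := hn _ (le_max_right m n)
      exact ⟨_, h1, h4, hp.eqT_trans hq⟩

variable (C) in
/-- The elements of type `σ` of the term model. -/
def Elt (σ : Ty) : Type := Quotient (C.setoid σ)

def toElt {σ : Ty} (n : ℕ) (t : Tm (C.Γ n) σ) : C.Elt σ := Quotient.mk (C.setoid σ) ⟨n, t⟩

theorem toElt_up {σ : Ty} {m n : ℕ} (h : m ≤ n) (t : Tm (C.Γ m) σ) :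
    (toElt n (t.subst (C.up h)) : C.Elt σ) = toElt m t := by
  refine Quotient.sound ⟨n, le_rfl, h, ?_⟩
  simpa only [C.up_self, Tm.subst_id] using Prv.eqT_refl _ _ _

theorem toElt_eq_toElt {σ : Ty} {n : ℕ} {s t : Tm (C.Γ n) σ} :
    (toElt n s : C.Elt σ) = toElt n t ↔ C.T n (Fml.eqT σ s t) := by
  refine Quotient.eq.trans ⟨?_, ?_⟩
  · rintro ⟨m, h, h', hp⟩
    exact ⟨m, h, by rwa [Fml.eqT_subst]⟩
  · rintro ⟨m, h, hp⟩
    exact ⟨m, h, h, by rwa [Fml.eqT_subst] at hp⟩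

theorem exists_toElt {σ : Ty} (d : C.Elt σ) : ∃ n t, d = toElt n t :=
  Quotient.inductionOn d fun ⟨n, t⟩ => ⟨n, t, rfl⟩

theorem exists_toElt_ge {σ : Ty} (d : C.Elt σ) (n : ℕ) : ∃ m, n ≤ m ∧ ∃ t, d = toElt m t := by
  obtain ⟨k, t, rfl⟩ := exists_toElt d
  exact ⟨max n k, le_max_left _ _, _, (toElt_up (le_max_right n k) t).symm⟩

def app {σ τ : Ty} : C.Elt (σ ⟶ₜ τ) → C.Elt σ → C.Elt τ :=
  Quotient.map₂ (fun a b => ⟨max a.1 b.1,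
    a.2.subst (C.up (le_max_left _ _)) ⬝ b.2.subst (C.up (le_max_right _ _))⟩) <| by
    intro a a' ha b b' hb
    obtain ⟨m, hm⟩ := Rel.lift ha
    obtain ⟨n, hn⟩ := Rel.lift hb
    obtain ⟨h1, h2, hp⟩ := hm _ (le_max_left m n)
    obtain ⟨h3, h4, hq⟩ := hn _ (le_max_right m n)
    refine ⟨max m n, max_le h1 h3, max_le h2 h4, ?_⟩
    simp only [Tm.subst_app, Tm.subst_subst, C.up_trans]
    exact hp.eqT_app hq

theorem app_toElt {σ τ : Ty} {n : ℕ} (s : Tm (C.Γ n) (σ ⟶ₜ τ)) (t : Tm (C.Γ n) σ) :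
    (app (toElt n s) (toElt n t) : C.Elt τ) = toElt n (s ⬝ t) := by
  rw [← toElt_up (le_max_left n n) (s ⬝ t)]
  rfl

/-- Agreement on all elements is agreement on all terms of later stages, which by `T_all` is the
pointwise equality of the two terms in the limit theory. -/
theorem app_ext {σ τ : Ty} {f g : C.Elt (σ ⟶ₜ τ)} (h : ∀ x, app f x = app g x) : f = g := by
  obtain ⟨n, s, rfl⟩ := exists_toElt f
  obtain ⟨m, hm, t, rfl⟩ := exists_toElt_ge g n
  rw [← toElt_up hm] at h ⊢
  refine toElt_eq_toElt.2 (T_all.2 fun k hk a => ?_)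
  have := h (toElt k a)
  rw [← toElt_up hk, ← toElt_up hk t, app_toElt, app_toElt, toElt_eq_toElt] at this
  simpa only [Fml.eqT_subst, Tm.subst_app, Tm.wk_subst_cons, Tm.subst_var,
    Sub.cons_zero] using this

variable (C) in
def tyStr : TyStr where
  D := C.Elt
  app := app
  cst c := toElt 0 (.cst c)
  ext := app_ext

/-- The environment given by a substitution. -/
def env {Γ : List Ty} {n : ℕ} (θ : Sub Γ (C.Γ n)) : C.tyStr.Env Γ := fun σ v => toElt n (θ σ v)

theorem cons_env {Γ : List Ty} {σ : Ty} {m n : ℕ} (h : n ≤ m) (t : Tm (C.Γ m) σ)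
    (θ : Sub Γ (C.Γ n)) :
    TyStr.Env.cons (M := C.tyStr) (toElt m t) (env θ) = env (Sub.cons t (θ.comp (C.up h))) :=
  TyStr.Env.ext_cons rfl fun _ _ => (toElt_up h _).symm

theorem eval_env {Γ : List Ty} {n : ℕ} (θ : Sub Γ (C.Γ n)) {σ : Ty} (t : Tm Γ σ) :
    C.tyStr.eval (env θ) t = toElt n (t.subst θ) := by
  induction t with
  | var v => rfl
  | cst c => exact (toElt_up (Nat.zero_le n) (.cst c)).symm
  | app s t ihs iht =>
    rw [TyStr.eval_app, ihs, iht]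
    exact app_toElt _ _

/-- The truth lemma: by `T_imp` and `T_all` the limit theory treats the connectives as satisfaction
does. -/
theorem sat_env {Γ : List Ty} (φ : Fml Γ) {n : ℕ} (θ : Sub Γ (C.Γ n)) :
    C.tyStr.Sat (env θ) φ ↔ C.T n (φ.subst θ) := by
  induction φ generalizing n with
  | eq s t =>
    rw [TyStr.sat_eq, eval_env, eval_env]
    exact toElt_eq_toElt
  | fls => exact ⟨False.elim, not_T_fls⟩
  | imp φ ψ ih1 ih2 => rw [TyStr.sat_imp, ih1, ih2, Fml.subst, T_imp]
  | all σ φ ih =>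
    have e : ∀ m (h : n ≤ m) t, (φ.subst (θ.lift σ)).subst (Sub.cons t (C.up h)) =
        φ.subst (Sub.cons t (θ.comp (C.up h))) := fun m h t => by
      rw [Fml.subst_subst, Sub.lift_comp_cons]
    rw [TyStr.sat_all, Fml.subst, T_all]
    constructor
    · intro H m h t
      rw [e, ← ih, ← cons_env]
      exact H _
    · intro H d
      obtain ⟨m, h, t, rfl⟩ := exists_toElt_ge d n
      rw [cons_env h, ih, ← e]
      exact H m h t

/-- A context is finite, so the terms naming the values can be moved to a common stage. Through
`sat_env` the axioms can then be checked for all parameters. -/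
theorem exists_env {Γ : List Ty} (ρ : C.tyStr.Env Γ) : ∃ n, ∃ θ : Sub Γ (C.Γ n), ρ = env θ := by
  induction Γ with
  | nil => exact ⟨0, nofun, TyStr.Env.ext_nil _ _⟩
  | cons τ Γ ih =>
    obtain ⟨n, θ, hθ⟩ := ih fun σ v => ρ σ v.succ
    obtain ⟨m, h, t, ht⟩ := exists_toElt_ge (C := C) (ρ τ Var.zero) n
    refine ⟨m, Sub.cons t (θ.comp (C.up h)), TyStr.Env.ext_cons ht fun σ v => ?_⟩
    exact (congrFun (congrFun hθ σ) v).trans (toElt_up h _).symm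

variable (C) in
def model : Model where
  toTyStr := C.tyStr
  models h ρ := by
    obtain ⟨n, θ, rfl⟩ := exists_env ρ
    exact (sat_env _ θ).2 (T_of_prv (.ax (h.subst θ)))

end Chain

/-- Completeness: a sentence which holds in all models of `RCA₀^ω` is provable. -/
theorem provable_of_forall_model {φ : Fml []} (h : ∀ M : Model, M.Sat TyStr.Env.nil φ) :
    Provable φ := by
  by_contra hφ
  obtain ⟨C, θ, hθ⟩ := exists_chain (Δ := [φ.neg]) fun h' => hφ (.raa h')
  have h1 := (Chain.sat_env φ.neg θ).2 (Chain.T_of_prv (.hyp (hθ _ List.mem_cons_self)))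
  rw [TyStr.Env.ext_nil (Chain.env θ) TyStr.Env.nil] at h1
  exact h1 (h C.model)

/-! ### Abstraction -/

/-- `λ x. t`, for the newest variable `x`. -/
def Tm.lam {Γ : List Ty} {σ : Ty} : {τ : Ty} → Tm (σ :: Γ) τ → Tm Γ (σ ⟶ₜ τ)
  | _, .var .zero => tcomb σ (σ ⟶ₜ σ) σ ⬝ tproj _ _ ⬝ tproj _ _
  | _, .var (.succ v) => tproj _ _ ⬝ .var v
  | _, .cst c => tproj _ _ ⬝ .cst c
  | _, .app s t => tcomb _ _ _ ⬝ s.lam ⬝ t.lam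

notation:90 f:90 " ⬪ " x:91 => TyStr.app _ f x

namespace Model

open TyStr

variable {M : Model}

theorem proj_app {σ τ : Ty} (a : M.D σ) (b : M.D τ) : M.cst (Cst.proj σ τ) ⬪ a ⬪ b = a :=
  (sat_eqT _ _ _ _).1 (M.models (Ax.proj x0 x1) ((Env.nil.cons b).cons a))

theorem comb_app {δ σ τ : Ty} (a : M.D (δ ⟶ₜ σ ⟶ₜ τ)) (b : M.D (δ ⟶ₜ σ)) (c : M.D δ) :
    M.cst (Cst.comb δ σ τ) ⬪ a ⬪ b ⬪ c = a ⬪ c ⬪ (b ⬪ c) :=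
  (sat_eqT _ _ _ _).1 (M.models (Ax.comb x0 x1 x2) (((Env.nil.cons c).cons b).cons a))

/-- Beta reduction, from the combinator equations. The closed terms below are computed with it. -/
theorem lam_app {Γ : List Ty} (ρ : M.Env Γ) {σ τ : Ty} (t : Tm (σ :: Γ) τ) (d : M.D σ) :
    M.eval ρ t.lam ⬪ d = M.eval (ρ.cons d) t := by
  induction t with
  | var v =>
    cases v with
    | zero => simp [Tm.lam, comb_app, proj_app]
    | succ v => simp [Tm.lam, proj_app]
  | cst c => simp [Tm.lam, proj_app]
  | app s t ihs iht => simp [Tm.lam, comb_app, ihs, iht]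

/-! ### Arithmetic in a model -/

/-- The numbers of a model. -/
abbrev N (M : Model) : Type := M.D Ty.nat

abbrev S (a : M.N) : M.N := M.cst Cst.succ ⬪ a

abbrev recN (n a : M.N) (b : M.D (Ty.nat ⟶ₜ Ty.nat ⟶ₜ Ty.nat)) : M.N :=
  M.cst Cst.recursor ⬪ n ⬪ a ⬪ b

instance : Zero M.N := ⟨M.cst Cst.zero⟩
instance : One M.N := ⟨S (M.cst Cst.zero)⟩
instance : Add M.N := ⟨fun a b => M.eval ((Env.nil.cons b).cons a) (tadd x0 x1)⟩
instance : Mul M.N := ⟨fun a b => M.eval ((Env.nil.cons b).cons a) (tmul x0 x1)⟩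

@[simp] theorem cst_zero : M.cst Cst.zero = (0 : M.N) := rfl

@[simp] theorem eval_tadd {Γ : List Ty} (ρ : M.Env Γ) (s t : Tm Γ Ty.nat) :
    M.eval ρ (tadd s t) = (M.eval ρ s + M.eval ρ t : M.N) := rfl

@[simp] theorem eval_tmul {Γ : List Ty} (ρ : M.Env Γ) (s t : Tm Γ Ty.nat) :
    M.eval ρ (tmul s t) = (M.eval ρ s * M.eval ρ t : M.N) := rfl

@[simp] theorem eval_tpair {Γ : List Ty} (ρ : M.Env Γ) (s t : Tm Γ Ty.nat) :
    M.eval ρ (tpair s t) =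
      ((M.eval ρ s + M.eval ρ t) * (M.eval ρ s + M.eval ρ t) + M.eval ρ s : M.N) := rfl

theorem recN_zero (a : M.N) (b) : recN 0 a b = a :=
  M.models (Ax.rec_zero x0 x1) ((Env.nil.cons b).cons a)

theorem recN_S (n a : M.N) (b) : recN (S n) a b = b ⬪ recN n a b ⬪ n :=
  M.models (Ax.rec_succ x0 x1 x2) (((Env.nil.cons b).cons a).cons n)

theorem S_ne_zero (n : M.N) : S n ≠ 0 := M.models (Ax.succ_ne_zero x0) (Env.nil.cons n)

theorem S_inj {m n : M.N} (h : S m = S n) : m = n :=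
  M.models (Ax.succ_inj x0 x1) ((Env.nil.cons n).cons m) h

theorem add_S (a b : M.N) : a + S b = S (a + b) := by
  refine (recN_S b a _).trans ?_
  simp [tconst2, comb_app, proj_app]
  rfl

protected theorem add_zero (a : M.N) : a + 0 = a := recN_zero _ _

@[simp] theorem S_eq (a : M.N) : S a = a + 1 := by
  refine Eq.trans ?_ (add_S a 0).symm
  rw [Model.add_zero]

theorem add_succ (a b : M.N) : a + (b + 1) = a + b + 1 := by simpa using add_S a b

theorem recN_succ (n a : M.N) (b) : recN (n + 1) a b = b ⬪ recN n a b ⬪ n := by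
  rw [← recN_S, S_eq]

theorem succ_ne_zero (n : M.N) : n + 1 ≠ 0 := by
  rw [← S_eq]
  exact S_ne_zero n

theorem succ_inj {m n : M.N} (h : m + 1 = n + 1) : m = n := by
  rw [← S_eq, ← S_eq n] at h
  exact S_inj h

protected theorem mul_zero (a : M.N) : a * 0 = 0 := recN_zero _ _

theorem mul_succ (a b : M.N) : a * (b + 1) = a * b + a := by
  refine (recN_succ b 0 _).trans ?_
  simp [tconst2, comb_app, proj_app]
  rfl

/-- Induction for quantifier-free formulas. -/
theorem induct {Γ : List Ty} (φ : Fml (Ty.nat :: Γ)) (hφ : φ.QF) (ρ : M.Env Γ)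
    (h0 : M.Sat (ρ.cons (0 : M.N)) φ)
    (hs : ∀ n : M.N, M.Sat (ρ.cons n) φ → M.Sat (ρ.cons (n + 1)) φ) (n : M.N) :
    M.Sat (ρ.cons n) φ := by
  refine M.models (Ax.ind φ hφ) ρ ?_ (fun m hm => ?_) n
  · rw [Fml.inst, sat_subst]
    exact cast (congrArg (fun η => M.Sat η φ) (Env.ext_cons rfl fun _ _ => rfl)) h0
  · rw [sat_subst]
    have e : ρ.cons (m + 1) = fun σ v =>
        M.eval (ρ.cons m) (Sub.cons (tsucc x0) (Sub.wk Ty.nat) σ v) :=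
      Env.ext_cons (S_eq m).symm fun _ _ => rfl
    exact e ▸ hs m hm

/-- Equations are quantifier-free, so the semiring laws follow once both sides are written as terms
with their parameters in `ρ`. -/
theorem induct_eq {Γ : List Ty} (s t : Tm (Ty.nat :: Γ) Ty.nat) (ρ : M.Env Γ)
    (h0 : M.eval (ρ.cons (0 : M.N)) s = M.eval (ρ.cons (0 : M.N)) t)
    (hs : ∀ n : M.N, M.eval (ρ.cons n) s = M.eval (ρ.cons n) t →
      M.eval (ρ.cons (n + 1)) s = M.eval (ρ.cons (n + 1)) t) (n : M.N) :
    M.eval (ρ.cons n) s = M.eval (ρ.cons n) t :=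
  induct (s ≐ t) (.eq s t) ρ h0 hs n

protected theorem zero_add (a : M.N) : 0 + a = a :=
  induct_eq (tadd tzero x0) x0 Env.nil (Model.add_zero 0)
    (fun n h => (add_succ 0 n).trans (congrArg (· + 1) h)) a

protected theorem add_assoc (a b c : M.N) : a + b + c = a + (b + c) :=
  induct_eq (tadd (tadd x1 x2) x0) (tadd x1 (tadd x2 x0)) ((Env.nil.cons b).cons a)
    (show a + b + 0 = a + (b + 0) by simp only [Model.add_zero])
    (fun n (h : a + b + n = a + (b + n)) => show a + b + (n + 1) = a + (b + (n + 1)) by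
      simp only [add_succ, h]) c

theorem succ_add (a b : M.N) : a + 1 + b = a + b + 1 :=
  induct_eq (tadd (tadd x1 tone) x0) (tadd (tadd x1 x0) tone) (Env.nil.cons a)
    (show a + 1 + 0 = a + 0 + 1 by simp only [Model.add_zero])
    (fun n (h : a + 1 + n = a + n + 1) => show a + 1 + (n + 1) = a + (n + 1) + 1 by
      simp only [add_succ, h]) b

protected theorem add_comm (a b : M.N) : a + b = b + a :=
  induct_eq (tadd x1 x0) (tadd x0 x1) (Env.nil.cons a)
    (show a + 0 = 0 + a by simp only [Model.add_zero, Model.zero_add])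
    (fun n (h : a + n = n + a) => show a + (n + 1) = n + 1 + a by
      simp only [add_succ, succ_add, h]) b

instance : AddCommMonoid M.N where
  add_assoc := Model.add_assoc
  zero_add := Model.zero_add
  add_zero := Model.add_zero
  add_comm := Model.add_comm
  nsmul := nsmulRec

protected theorem left_distrib (a b c : M.N) : a * (b + c) = a * b + a * c :=
  induct_eq (tmul x1 (tadd x2 x0)) (tadd (tmul x1 x2) (tmul x1 x0)) ((Env.nil.cons b).cons a)
    (show a * (b + 0) = a * b + a * 0 by simp only [add_zero, Model.mul_zero])
    (fun n (h : a * (b + n) = a * b + a * n) =>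
      show a * (b + (n + 1)) = a * b + a * (n + 1) by
        rw [← add_assoc, mul_succ, mul_succ, h, add_assoc]) c

protected theorem zero_mul (a : M.N) : 0 * a = 0 :=
  induct_eq (tmul tzero x0) tzero Env.nil (Model.mul_zero 0)
    (fun n h => (mul_succ 0 n).trans ((add_zero _).trans h)) a

theorem succ_mul (a b : M.N) : (a + 1) * b = a * b + b :=
  induct_eq (tmul (tadd x1 tone) x0) (tadd (tmul x1 x0) x0) (Env.nil.cons a)
    (show (a + 1) * 0 = a * 0 + 0 by simp only [Model.mul_zero, add_zero])
    (fun n (h : (a + 1) * n = a * n + n) => show (a + 1) * (n + 1) = a * (n + 1) + (n + 1) by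
      rw [mul_succ, mul_succ, h]
      ac_rfl) b

protected theorem mul_comm (a b : M.N) : a * b = b * a :=
  induct_eq (tmul x1 x0) (tmul x0 x1) (Env.nil.cons a)
    (show a * 0 = 0 * a by simp only [Model.mul_zero, Model.zero_mul])
    (fun n (h : a * n = n * a) => show a * (n + 1) = (n + 1) * a by
      rw [mul_succ, succ_mul, h]) b

protected theorem mul_assoc (a b c : M.N) : a * b * c = a * (b * c) :=
  induct_eq (tmul (tmul x1 x2) x0) (tmul x1 (tmul x2 x0)) ((Env.nil.cons b).cons a)
    (show a * b * 0 = a * (b * 0) by simp only [Model.mul_zero])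
    (fun n (h : a * b * n = a * (b * n)) => show a * b * (n + 1) = a * (b * (n + 1)) by
      rw [mul_succ, mul_succ, h, Model.left_distrib]) c

protected theorem mul_one (a : M.N) : a * 1 = a := by
  rw [← zero_add 1, mul_succ, Model.mul_zero, zero_add]

instance : CommSemiring M.N where
  left_distrib := Model.left_distrib
  right_distrib a b c := by
    rw [Model.mul_comm, Model.left_distrib, Model.mul_comm c, Model.mul_comm c]
  zero_mul := Model.zero_mul
  mul_zero := Model.mul_zero
  mul_assoc := Model.mul_assoc
  mul_comm := Model.mul_comm
  one_mul a := by rw [Model.mul_comm, Model.mul_one]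
  mul_one := Model.mul_one
  nsmul := nsmulRec
  npow := npowRec

protected theorem add_right_cancel {a b : M.N} (c : M.N) : a + c = b + c → a = b :=
  induct (tadd x1 x0 ≐ tadd x2 x0 ⊃ₑ x1 ≐ x2) (.imp (.eq _ _) (.eq _ _))
    ((Env.nil.cons b).cons a)
    (show a + 0 = b + 0 → a = b by simp)
    (fun n (h : a + n = b + n → a = b) => show a + (n + 1) = b + (n + 1) → a = b from
      fun h' => h (succ_inj (by simpa only [add_assoc] using h'))) c

/-! ### Truncated subtraction and the order -/

end Model

/-- The predecessor of a number. -/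
def predTm : Tm [] (Ty.nat ⟶ₜ Ty.nat) :=
  (trec ⬝ x0 ⬝ tzero ⬝ (x0 : Tm [Ty.nat, Ty.nat, Ty.nat] _).lam.lam).lam

/-- Truncated subtraction. -/
def monusTm : Tm [] (Ty.nat ⟶ₜ Ty.nat ⟶ₜ Ty.nat) :=
  (trec ⬝ x0 ⬝ x1 ⬝ (predTm.ofClosed ⬝ x1 : Tm [Ty.nat, Ty.nat] _).lam.lam.ofClosed).lam.lam

/-- `condTm ⬝ c ⬝ a ⬝ b` is `a` if `c = 0`, and `b` otherwise. -/
def condTm : Tm [] (Ty.nat ⟶ₜ Ty.nat ⟶ₜ Ty.nat ⟶ₜ Ty.nat) :=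
  (trec ⬝ x2 ⬝ x1 ⬝ (tproj _ _ ⬝ (tproj _ _ ⬝ x0))).lam.lam.lam

abbrev tmonus {Γ : List Ty} (a b : Tm Γ Ty.nat) : Tm Γ Ty.nat := monusTm.ofClosed ⬝ a ⬝ b

abbrev tcond {Γ : List Ty} (c a b : Tm Γ Ty.nat) : Tm Γ Ty.nat := condTm.ofClosed ⬝ c ⬝ a ⬝ b

namespace Model

open TyStr

variable {M : Model}

instance : _root_.Sub M.N := ⟨fun a b => M.eval Env.nil monusTm ⬪ a ⬪ b⟩


@[simp] theorem monusTm_app (a b : M.N) : M.eval Env.nil monusTm ⬪ a ⬪ b = a - b := rfl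

theorem eval_tmonus {Γ : List Ty} (ρ : M.Env Γ) (s t : Tm Γ Ty.nat) :
    M.eval ρ (tmonus s t) = (M.eval ρ s - M.eval ρ t : M.N) := by
  simp only [tmonus, eval_app, eval_ofClosed]
  rfl

theorem predTm_zero : M.eval Env.nil predTm ⬪ (0 : M.N) = (0 : M.N) := by
  rw [predTm, lam_app]
  exact recN_zero _ _

theorem predTm_succ (n : M.N) : M.eval Env.nil predTm ⬪ (n + 1) = n := by
  rw [predTm, lam_app]
  refine (recN_succ _ _ _).trans ?_
  simp [lam_app]

theorem sub_eq_recN (a b : M.N) : a - b = recN b a (M.eval Env.nil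
    (predTm.ofClosed ⬝ x1 : Tm [Ty.nat, Ty.nat] _).lam.lam) := by
  refine Eq.trans (show a - b = M.eval Env.nil monusTm ⬪ a ⬪ b from rfl) ?_
  rw [monusTm, lam_app, lam_app]
  simp

protected theorem sub_zero (a : M.N) : a - 0 = a := (sub_eq_recN _ _).trans (recN_zero _ _)

theorem sub_succ (a b : M.N) : a - (b + 1) = M.eval Env.nil predTm ⬪ (a - b) := by
  rw [sub_eq_recN, recN_succ, ← sub_eq_recN, lam_app, lam_app]
  simp

theorem succ_sub_succ (a b : M.N) : a + 1 - (b + 1) = a - b := by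
  have h := induct_eq (tmonus (tadd x1 tone) (tadd x0 tone)) (tmonus x1 x0) (Env.nil.cons a)
    (by
      simp only [eval_tmonus]
      show a + 1 - (0 + 1) = a - 0
      rw [sub_succ, Model.sub_zero, Model.sub_zero, predTm_succ])
    (fun n => by
      simp only [eval_tmonus]
      show a + 1 - (n + 1) = a - n → a + 1 - (n + 1 + 1) = a - (n + 1)
      intro h
      rw [sub_succ, h, sub_succ]) b
  rw [eval_tmonus, eval_tmonus] at h
  exact h

theorem add_sub_cancel_left (a c : M.N) : a + c - a = c := by
  have h := induct_eq (tmonus (tadd x0 x1) x0) x1 (Env.nil.cons c)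
    (by
      simp only [eval_tmonus]
      show 0 + c - 0 = c
      rw [zero_add, Model.sub_zero])
    (fun n => by
      simp only [eval_tmonus]
      show n + c - n = c → n + 1 + c - (n + 1) = c
      intro h
      rw [succ_add, succ_sub_succ, h]) a
  rw [eval_tmonus] at h
  exact h

theorem sub_add_self (a c : M.N) : a - (a + c) = 0 := by
  have h := induct_eq (tmonus x1 (tadd x1 x0)) tzero (Env.nil.cons a)
    (by
      simp only [eval_tmonus]
      show a - (a + 0) = 0
      simpa using add_sub_cancel_left a 0)
    (fun n => by
      simp only [eval_tmonus]
      show a - (a + n) = 0 → a - (a + (n + 1)) = 0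
      intro h
      rw [← add_assoc, sub_succ, h, predTm_zero]) c
  rw [eval_tmonus] at h
  exact h

/-- The predecessor term names the witness, so that the formula proved by induction has no
quantifier. -/
theorem eq_zero_or_succ (n : M.N) : n = 0 ∨ ∃ m, n = m + 1 := by
  refine Classical.or_iff_not_imp_left.2 fun hn => ⟨M.eval Env.nil predTm ⬪ n, ?_⟩
  exact induct ((x0 ≐ tzero).neg ⊃ₑ x0 ≐ tadd (predTm.ofClosed ⬝ x0) tone)
    (.imp (.imp (.eq _ _) .fls) (.eq _ _)) Env.nil
    (show ¬ (0 : M.N) = 0 → _ from fun h => absurd rfl h)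
    (fun n _ _ => by
      simp only [sat_eq, eval_tadd, eval_app, eval_ofClosed, eval_var, Env.cons_zero]
      rw [predTm_succ]
      rfl) n hn

/-- Totality of the order, with the difference named by truncated subtraction to make it
quantifier-free. -/
theorem eq_add_sub_or (a b : M.N) : b = a + (b - a) ∨ a = b + (a - b) := by
  have h : M.Sat ((Env.nil.cons a).cons b) _ :=
    induct ((x0 ≐ tadd x1 (tmonus x0 x1)).or (x1 ≐ tadd x0 (tmonus x1 x0)))
      (.imp (.imp (.eq _ _) .fls) (.eq _ _)) (Env.nil.cons a) ?_ ?_ b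
  · rw [sat_or, sat_eq, sat_eq, eval_tadd, eval_tmonus, eval_tadd, eval_tmonus] at h
    exact h
  · simp only [sat_or, sat_eq, eval_tadd, eval_tmonus]
    exact .inr (show a = 0 + (a - 0) by rw [zero_add, Model.sub_zero])
  · intro n
    simp only [sat_or, sat_eq, eval_tadd, eval_tmonus]
    show n = a + (n - a) ∨ a = n + (a - n) →
      n + 1 = a + (n + 1 - a) ∨ a = n + 1 + (a - (n + 1))
    rintro (h | h)
    · generalize n - a = c at h
      subst h
      rw [add_assoc, add_sub_cancel_left]
      exact .inl rfl
    · generalize a - n = c at h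
      subst h
      -- If `c = 0` then `a = n`, and the induction step moves to the first alternative.
      rcases eq_zero_or_succ c with rfl | ⟨d, rfl⟩
      · rw [add_zero, add_sub_cancel_left]
        exact .inl rfl
      · rw [add_comm d, ← add_assoc, add_sub_cancel_left]
        exact .inr rfl

instance : IsRightCancelAdd M.N := ⟨fun c _ _ h => Model.add_right_cancel c h⟩
instance : IsLeftCancelAdd M.N :=
  ⟨fun c a b h => Model.add_right_cancel c (by rwa [add_comm a, add_comm b])⟩
instance : IsCancelAdd M.N where

theorem eq_zero_of_add_eq_zero {a b : M.N} (h : a + b = 0) : b = 0 := by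
  rcases eq_zero_or_succ b with rfl | ⟨c, rfl⟩
  · rfl
  · rw [← add_assoc] at h
    exact absurd h (succ_ne_zero _)

instance : LE M.N := ⟨fun a b => ∃ c, b = a + c⟩

protected theorem le_def {a b : M.N} : a ≤ b ↔ ∃ c, b = a + c := Iff.rfl

open Classical in
noncomputable instance : LinearOrder M.N where
  le_refl a := ⟨0, (add_zero a).symm⟩
  le_trans := by
    rintro a _ _ ⟨c, rfl⟩ ⟨d, rfl⟩
    exact ⟨c + d, add_assoc _ _ _⟩
  le_antisymm := by
    rintro a _ ⟨c, rfl⟩ ⟨d, h⟩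
    have : a + 0 = a + (c + d) := by rw [add_zero, ← add_assoc, ← h]
    have h0 : c + d = 0 := (add_left_cancel this).symm
    rw [add_comm] at h0
    rw [eq_zero_of_add_eq_zero h0, add_zero]
  le_total a b := (eq_add_sub_or a b).imp (fun h => ⟨_, h⟩) fun h => ⟨_, h⟩
  toDecidableLE := Classical.decRel _

instance : CanonicallyOrderedAdd M.N where
  exists_add_of_le h := h
  le_add_self _ b := ⟨b, add_comm _ _⟩
  le_self_add _ b := ⟨b, rfl⟩

instance : IsOrderedCancelAddMonoid M.N where
  add_le_add_left a b := by
    rintro ⟨c, rfl⟩ d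
    exact ⟨c, by ac_rfl⟩
  le_of_add_le_add_left a b c := by
    rintro ⟨d, h⟩
    rw [add_assoc] at h
    exact ⟨d, add_left_cancel h⟩

theorem lt_iff_add_one_le {a b : M.N} : a < b ↔ a + 1 ≤ b := by
  rw [lt_iff_le_and_ne]
  constructor
  · rintro ⟨⟨c, rfl⟩, h⟩
    rcases eq_zero_or_succ c with rfl | ⟨d, rfl⟩
    · simp at h
    · exact ⟨d, by ac_rfl⟩
  · rintro ⟨c, rfl⟩
    refine ⟨⟨1 + c, by ac_rfl⟩, fun h => succ_ne_zero c ?_⟩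
    have : a + 0 = a + (c + 1) := by rw [add_zero]; exact h.trans (by ac_rfl)
    exact (add_left_cancel this).symm

theorem lt_add_one_iff {a b : M.N} : a < b + 1 ↔ a ≤ b := by
  rw [lt_iff_add_one_le, add_le_add_iff_right]

/-- The order is defined by an existential quantifier. As an equation it can occur in the induction
formulas below. -/
theorem sub_eq_zero {a b : M.N} : a - b = 0 ↔ a ≤ b := by
  constructor
  · intro h
    rcases eq_add_sub_or a b with h' | h'
    · exact ⟨_, h'⟩
    · rw [h, add_zero] at h'
      exact h'.le
  · rintro ⟨c, rfl⟩
    exact sub_add_self a c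

@[simp] theorem condTm_app (c a b : M.N) :
    M.eval Env.nil condTm ⬪ c ⬪ a ⬪ b = if c = 0 then a else b := by
  rw [condTm, lam_app, lam_app, lam_app]
  split_ifs with h
  · rw [h]
    exact recN_zero _ _
  · obtain ⟨d, rfl⟩ := (eq_zero_or_succ c).resolve_left h
    refine (recN_succ _ _ _).trans ?_
    simp [proj_app]

theorem sat_ltN {Γ : List Ty} (ρ : M.Env Γ) (s t : Tm Γ Ty.nat) :
    M.Sat ρ (ltN s t) ↔ (M.eval ρ s : M.N) < M.eval ρ t := by
  rw [ltN, sat_ex, lt_iff_add_one_le, Model.le_def]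
  refine exists_congr fun d => ?_
  rw [sat_eq, eval_tadd, eval_wk, eval_wk, eq_comm]
  refine Eq.congr_right ?_
  refine Eq.trans ?_ (add_assoc _ _ _).symm
  rw [add_comm (1 : M.N)]
  exact congrArg _ (S_eq _)

end Model
abbrev x3 {Γ : List Ty} {σ τ υ δ : Ty} : Tm (δ :: υ :: τ :: σ :: Γ) σ :=
  Tm.var Var.zero.succ.succ.succ

namespace Model

open TyStr

variable {M : Model}

/-! ### The principles in a model -/

/-- The pairing function. -/
def pair (i j : M.N) : M.N := (i + j) * (i + j) + i

/-- The relation coded by `X`. -/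
def LeX (X : M.D Ty.one) (i j : M.N) : Prop := X ⬪ pair i j = (1 : M.N)

def LtX (X : M.D Ty.one) (i j : M.N) : Prop := LeX X i j ∧ ¬ LeX X j i

structure IsLOinf (X : M.D Ty.one) : Prop where
  isSet : ∀ n : M.N, X ⬪ n = (0 : M.N) ∨ X ⬪ n = (1 : M.N)
  field : ∀ i j : M.N, LeX X i j → LeX X i i ∧ LeX X j j
  trans : ∀ i j k : M.N, LeX X i j → LeX X j k → LeX X i k
  antisymm : ∀ i j : M.N, LeX X i j → LeX X j i → i = j
  total : ∀ i j : M.N, LeX X i i → LeX X j j → LeX X i j ∨ LeX X j i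
  unbounded : ∀ n : M.N, ∃ m : M.N, LeX X m m ∧ n < m

section
variable {Γ : List Ty} (ρ : M.Env Γ)

theorem sat_leX (X : Tm Γ Ty.one) (i j : Tm Γ Ty.nat) :
    M.Sat ρ (leX X i j) ↔ LeX (M.eval ρ X) (M.eval ρ i) (M.eval ρ j) := Iff.rfl

theorem sat_ltX (X : Tm Γ Ty.one) (i j : Tm Γ Ty.nat) :
    M.Sat ρ (ltX X i j) ↔ LtX (M.eval ρ X) (M.eval ρ i) (M.eval ρ j) := sat_and _ _ _

theorem sat_LOinf (X : Tm Γ Ty.one) : M.Sat ρ (LOinf X) ↔ IsLOinf (M.eval ρ X) := by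
  rw [LOinf, LO, sat_and, sat_and, sat_and, sat_and, sat_and]
  simp only [RCAω.isSet, fieldX, sat_all, sat_imp, sat_fls, sat_leX, sat_ltN, eval_wk, sat_eq,
    eval_app, eval_var, Env.cons_zero, Env.cons_succ, eval_cst, cst_zero, S_eq, zero_add,
    imp_false, Classical.not_imp, not_not, not_forall, ← Classical.or_iff_not_imp_left]
  constructor
  · rintro ⟨⟨h1, h2, h3, h4, h5⟩, h6⟩
    exact ⟨h1, h2, h3, h4, h5, h6⟩
  · rintro ⟨h1, h2, h3, h4, h5, h6⟩
    exact ⟨⟨h1, h2, h3, h4, h5⟩, h6⟩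

theorem sat_UADSmatrix (ρ : M.Env [Ty.one ⟶ₜ Ty.one]) :
    M.Sat ρ UADSmatrix ↔ ∀ X : M.D Ty.one, IsLOinf X →
      (∀ n : M.N, LtX X (ρ _ .zero ⬪ X ⬪ n) (ρ _ .zero ⬪ X ⬪ (n + 1))) ∨
      (∀ n : M.N, LtX X (ρ _ .zero ⬪ X ⬪ (n + 1)) (ρ _ .zero ⬪ X ⬪ n)) := by
  rw [UADSmatrix, sat_all]
  refine forall_congr' fun X => ?_
  rw [sat_imp, sat_LOinf, sat_or, ascending, descending, sat_all, sat_all]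
  simp only [sat_ltX, eval_wk, eval_app, ← S_eq]
  exact Iff.rfl

theorem sat_MUmatrix (ρ : M.Env [Ty.two]) :
    M.Sat ρ MUmatrix ↔ ∀ f : M.D Ty.one, (∃ n : M.N, f ⬪ n = (0 : M.N)) →
      f ⬪ (ρ _ .zero ⬪ f) = (0 : M.N) := by
  rw [MUmatrix, sat_all]
  refine forall_congr' fun X => ?_
  rw [sat_imp, sat_ex]
  exact Iff.rfl

end

end Model

/-! ### Decoding pairs -/

def sqrtStepTm : Tm [] (Ty.nat ⟶ₜ Ty.nat ⟶ₜ Ty.nat) :=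
  (tcond (tmonus (tmul (tsucc x1) (tsucc x1)) (tsucc x0)) (tsucc x1) x1).lam.lam

def sqrtTm : Tm [] (Ty.nat ⟶ₜ Ty.nat) := (trec ⬝ x0 ⬝ tzero ⬝ sqrtStepTm.ofClosed).lam

namespace Model

open TyStr

variable {M : Model}

/-- The integer square root. -/
def sqrt (k : M.N) : M.N := M.eval Env.nil sqrtTm ⬪ k

theorem zero_ne_one : (0 : M.N) ≠ 1 := fun h => succ_ne_zero (0 : M.N) (by rw [zero_add, ← h])

theorem one_ne_zero : (1 : M.N) ≠ 0 := zero_ne_one.symm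

@[simp] theorem sqrtTm_app (k : M.N) : M.eval Env.nil sqrtTm ⬪ k = sqrt k := rfl

theorem sqrt_eq_recN (k : M.N) : sqrt k = recN k 0 (M.eval Env.nil sqrtStepTm) := by
  rw [sqrt, sqrtTm, lam_app]
  simp

theorem sqrt_zero : sqrt (0 : M.N) = 0 := (sqrt_eq_recN _).trans (recN_zero _ _)

theorem sqrt_succ (k : M.N) : sqrt (k + 1) =
    if (sqrt k + 1) * (sqrt k + 1) ≤ k + 1 then sqrt k + 1 else sqrt k := by
  rw [sqrt_eq_recN, recN_succ, ← sqrt_eq_recN, sqrtStepTm]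
  simp [lam_app, sub_eq_zero]

theorem sqrt_spec (k : M.N) : sqrt k * sqrt k ≤ k ∧ k < (sqrt k + 1) * (sqrt k + 1) := by
  have h : M.Sat (Env.nil.cons k) _ :=
    induct ((tmonus (tmul (sqrtTm.ofClosed ⬝ x0) (sqrtTm.ofClosed ⬝ x0)) x0 ≐ tzero).and
      (tmonus (tmul (tsucc (sqrtTm.ofClosed ⬝ x0)) (tsucc (sqrtTm.ofClosed ⬝ x0))) x0 ≐
        tzero).neg) (by repeat constructor) Env.nil ?_ ?_ k
  · simpa [sub_eq_zero] using h
  · simp [sub_eq_zero, sqrt_zero, one_ne_zero]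
  · intro k
    simp only [sat_imp, sat_fls, sat_eq, eval_tmul, eval_app, eval_ofClosed, eval_var,
      eval_cst, cst_zero, Env.cons_zero, monusTm_app, S_eq, sub_eq_zero, imp_false,
      Classical.not_imp, not_not, not_le, sqrtTm_app, sqrt_succ]
    rintro ⟨h1, h2⟩
    split_ifs with h
    · refine ⟨h, ?_⟩
      rw [lt_iff_add_one_le] at h2
      -- `(sqrt k + 2)²` exceeds `(sqrt k + 1)²` by `2 * sqrt k + 3`, and strictness uses up one.
      exact h2.trans_lt (lt_iff_add_one_le.2 ⟨2 * sqrt k + 2, by ring⟩)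
    · exact ⟨h1.trans ⟨1, rfl⟩, not_le.1 h⟩

theorem mul_self_le {a b : M.N} (h : a ≤ b) : a * a ≤ b * b := by
  obtain ⟨c, rfl⟩ := h
  exact ⟨2 * a * c + c * c, by ring⟩

theorem sqrt_unique {k r s : M.N} (hr : r * r ≤ k) (hs : k < (s + 1) * (s + 1)) : r ≤ s := by
  by_contra h
  have := mul_self_le (lt_iff_add_one_le.1 (not_le.1 h))
  exact absurd (this.trans hr) (not_le.2 hs)

/-- The code `(i + j)² + i` lies between the squares of `i + j` and `i + j + 1`. -/
theorem sqrt_pair (i j : M.N) : sqrt (pair i j) = i + j := by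
  obtain ⟨h1, h2⟩ := sqrt_spec (pair i j)
  refine le_antisymm (sqrt_unique h1 ?_) (sqrt_unique ⟨i, rfl⟩ h2)
  rw [lt_iff_add_one_le]
  exact ⟨i + j + j, by rw [pair]; ring⟩

/-- A sequence of numbers with values in a decidable set is not strictly decreasing. -/
theorem false_of_descent (χ y : M.D Ty.one) (h0 : χ ⬪ (y ⬪ (0 : M.N)) = (0 : M.N))
    (h : ∀ n : M.N, χ ⬪ (y ⬪ n) = (0 : M.N) →
      χ ⬪ (y ⬪ (n + 1)) = (0 : M.N) ∧ (y ⬪ (n + 1) : M.N) < y ⬪ n) : False := by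
  -- Each step loses at least one. Membership in the set is carried along because the descent is
  -- assumed only there.
  have key : ∀ n : M.N, χ ⬪ (y ⬪ n) = (0 : M.N) ∧ (y ⬪ n : M.N) + n ≤ y ⬪ (0 : M.N) := by
    intro n
    have := induct ((x1 ⬝ (x2 ⬝ x0) ≐ tzero).and
      (tmonus (tadd (x2 ⬝ x0) x0) (x2 ⬝ tzero) ≐ tzero)) (by repeat constructor)
      ((Env.nil.cons y).cons χ) ?_ ?_ n
    · simpa [sub_eq_zero] using this
    · simpa [sub_eq_zero] using h0
    · intro n
      simp only [sat_imp, sat_fls, sat_eq, eval_tadd, eval_app, eval_ofClosed, eval_var,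
        eval_cst, cst_zero, Env.cons_zero, Env.cons_succ, monusTm_app, sub_eq_zero, imp_false,
        Classical.not_imp, not_not]
      rintro ⟨h1, h2⟩
      obtain ⟨h3, h4⟩ := h n h1
      refine ⟨h3, le_trans ?_ h2⟩
      rw [add_comm n 1, ← add_assoc, add_comm 1 n]
      exact add_le_add_left (lt_iff_add_one_le.1 h4) n
  -- With `n` one more than the starting value, the bound is violated.
  have h1 := (key (y ⬪ (0 : M.N) + 1)).2
  exact absurd (le_add_self.trans h1) (not_le.2 (lt_add_one_iff.2 le_rfl))

end Model

/-! ### Bounded search, and an order whose sequences reveal zeros -/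

/-- `λ f p q. if f p = 0 then p else S q`. -/
def searchStepTm : Tm [] (Ty.one ⟶ₜ Ty.nat ⟶ₜ Ty.nat ⟶ₜ Ty.nat) :=
  (tcond (x2 ⬝ x1) x1 (tsucc x0)).lam.lam.lam

/-- Bounded search: `searchTm ⬝ f ⬝ n` is the least zero of `f` up to `n`, or else `n`. -/
def searchTm : Tm [] (Ty.one ⟶ₜ Ty.nat ⟶ₜ Ty.nat) :=
  (trec ⬝ x0 ⬝ tzero ⬝ (searchStepTm.ofClosed ⬝ x1)).lam.lam

/-- `lateTm ⬝ f ⬝ n` is `0` if and only if `f` has a zero up to `n`. -/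
def lateTm : Tm [] (Ty.one ⟶ₜ Ty.nat ⟶ₜ Ty.nat) :=
  (x1 ⬝ (searchTm.ofClosed ⬝ x1 ⬝ x0)).lam.lam

def earlyTm : Tm [] (Ty.one ⟶ₜ Ty.nat ⟶ₜ Ty.nat) :=
  (tcond (lateTm.ofClosed ⬝ x1 ⬝ x0) tone tzero).lam.lam

/-- The relation in which the early numbers are ordered as usual, and are followed by the late
ones in reverse order. -/
def relTm : Tm [] (Ty.one ⟶ₜ Ty.nat ⟶ₜ Ty.nat ⟶ₜ Ty.nat) :=
  (tcond (lateTm.ofClosed ⬝ x2 ⬝ x1)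
    (tcond (lateTm.ofClosed ⬝ x2 ⬝ x0) (tcond (tmonus x0 x1) tone tzero) tzero)
    (tcond (lateTm.ofClosed ⬝ x2 ⬝ x0) tone
      (tcond (tmonus x1 x0) tone tzero))).lam.lam.lam

/-- Decodes `k = r² + i`, where `r = i + j` is the root of `k`, by `i = k - r²` and `j = r - i`. At
numbers that code no pair, the value only has to be binary. -/
def ordTm : Tm [] (Ty.one ⟶ₜ Ty.one) :=
  (relTm.ofClosed ⬝ x1 ⬝ tmonus x0 (tmul (sqrtTm.ofClosed ⬝ x0) (sqrtTm.ofClosed ⬝ x0)) ⬝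
    tmonus (sqrtTm.ofClosed ⬝ x0)
      (tmonus x0 (tmul (sqrtTm.ofClosed ⬝ x0) (sqrtTm.ofClosed ⬝ x0)))).lam.lam

/-- The functional `μ` defined from `Ψ`. -/
def muTm : Tm [] ((Ty.one ⟶ₜ Ty.one) ⟶ₜ Ty.two) :=
  (searchTm.ofClosed ⬝ x0 ⬝ (x1 ⬝ (ordTm.ofClosed ⬝ x0) ⬝ tzero)).lam.lam

/-! ### From `Ψ` to `μ`: monotone sequences in the order attached to `f` -/

namespace Model

open TyStr

variable {M : Model} (f : M.D Ty.one)

def search (n : M.N) : M.N := M.eval Env.nil searchTm ⬪ f ⬪ n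

@[simp] theorem searchTm_app (n : M.N) : M.eval Env.nil searchTm ⬪ f ⬪ n = search f n := rfl

theorem search_eq_recN (n : M.N) :
    search f n = recN n 0 (M.eval Env.nil searchStepTm ⬪ f) := by
  rw [search, searchTm, lam_app, lam_app]
  simp

theorem search_zero : search f 0 = 0 := (search_eq_recN _ _).trans (recN_zero _ _)

theorem search_succ (n : M.N) : search f (n + 1) =
    if f ⬪ search f n = (0 : M.N) then search f n else n + 1 := by
  rw [search_eq_recN, recN_succ, ← search_eq_recN, searchStepTm]
  simp [lam_app]

/-- The search ends at a zero exactly when there is one up to `n`; in this form the notion is an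
equation. -/
def Late (n : M.N) : Prop := f ⬪ search f n = (0 : M.N)

theorem lateTm_app (n : M.N) : M.eval Env.nil lateTm ⬪ f ⬪ n = f ⬪ search f n := by
  rw [lateTm, lam_app, lam_app]
  simp

theorem lateTm_app_eq_zero {n : M.N} :
    M.eval Env.nil lateTm ⬪ f ⬪ n = (0 : M.N) ↔ Late f n := by
  rw [lateTm_app, Late]

theorem earlyTm_app_eq_zero {n : M.N} :
    M.eval Env.nil earlyTm ⬪ f ⬪ n = (0 : M.N) ↔ ¬ Late f n := by
  rw [earlyTm, lam_app, lam_app]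
  simp [lateTm_app_eq_zero, one_ne_zero]

variable {f}

/-- The search keeps a zero once it has found one. -/
theorem Late.mono {m n : M.N} (h : Late f m) (hmn : m ≤ n) : Late f n := by
  obtain ⟨c, rfl⟩ := hmn
  have := induct (x1 ⬝ (searchTm.ofClosed ⬝ x1 ⬝ tadd x2 x0) ≐ tzero) (.eq _ _)
    ((Env.nil.cons m).cons f) ?_ ?_ c
  · simpa [Late] using this
  · simpa [Late] using h
  · intro n
    simp only [sat_eq, eval_tadd, eval_app, eval_ofClosed, eval_var,
        eval_cst, cst_zero, Env.cons_zero, Env.cons_succ, searchTm_app]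
    intro h
    rw [← add_assoc, search_succ, if_pos h, h]

theorem late_of_eq_zero {n : M.N} (h : f ⬪ n = (0 : M.N)) : Late f n := by
  rcases eq_zero_or_succ n with rfl | ⟨m, rfl⟩
  · rwa [Late, search_zero]
  · rw [Late, search_succ]
    split_ifs with h'
    · exact h'
    · exact h

variable (f) in
def Rel (i j : M.N) : Prop :=
  (¬ Late f i ∧ Late f j) ∨ (¬ Late f i ∧ ¬ Late f j ∧ i ≤ j) ∨ (Late f i ∧ Late f j ∧ j ≤ i)

theorem relTm_app_eq (i j : M.N) [Decidable (Rel f i j)] : M.eval Env.nil relTm ⬪ f ⬪ i ⬪ j =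
    if Rel f i j then (1 : M.N) else 0 := by
  classical
  rw [relTm, lam_app, lam_app, lam_app]
  simp only [eval_app, eval_var, eval_ofClosed, condTm_app, Env.cons_zero, Env.cons_succ,
    lateTm_app_eq_zero, monusTm_app, sub_eq_zero, eval_cst, cst_zero, S_eq, zero_add]
  by_cases hi : Late f i <;> by_cases hj : Late f j <;> simp [Rel, hi, hj]

theorem ordTm_app (k : M.N) : M.eval Env.nil ordTm ⬪ f ⬪ k =
    M.eval Env.nil relTm ⬪ f ⬪ (k - sqrt k * sqrt k) ⬪ (sqrt k - (k - sqrt k * sqrt k)) := by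
  rw [ordTm, lam_app, lam_app]
  simp

theorem ordTm_isSet (k : M.N) : M.eval Env.nil ordTm ⬪ f ⬪ k = (0 : M.N) ∨
    M.eval Env.nil ordTm ⬪ f ⬪ k = (1 : M.N) := by
  classical
  rw [ordTm_app, relTm_app_eq]
  split_ifs
  · exact .inr rfl
  · exact .inl rfl

theorem leX_ordTm {i j : M.N} : LeX (M.eval Env.nil ordTm ⬪ f) i j ↔ Rel f i j := by
  classical
  rw [LeX, ordTm_app, sqrt_pair, pair, add_sub_cancel_left, add_sub_cancel_left, relTm_app_eq]
  split_ifs with h <;> simp [h, zero_ne_one]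

/-- The early numbers form an initial segment ordered by `≤` and the late ones a final segment
ordered by `≥`, so each law follows propositionally from the laws of `≤`. Every number is in the
field. -/
theorem isLOinf_ordTm : IsLOinf (M.eval Env.nil ordTm ⬪ f) where
  isSet := ordTm_isSet
  field i j _ := by
    simp only [leX_ordTm, Rel, le_refl]
    tauto
  trans i j k := by
    simp only [leX_ordTm, Rel]
    intro h h'
    have := le_trans (a := i) (b := j) (c := k)
    -- For three late numbers, where the order is reversed.
    have := le_trans (a := k) (b := j) (c := i)
    tauto
  antisymm i j := by
    simp only [leX_ordTm, Rel]
    intro h h'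
    have := le_antisymm (a := i) (b := j)
    tauto
  total i j := by
    simp only [leX_ordTm, Rel]
    have := le_total i j
    tauto
  unbounded n := by
    refine ⟨n + 1, ?_, lt_add_one_iff.2 le_rfl⟩
    simp only [leX_ordTm, Rel, le_refl]
    tauto

theorem ltX_ordTm {i j : M.N} : LtX (M.eval Env.nil ordTm ⬪ f) i j ↔
    (¬ Late f i ∧ Late f j) ∨ (¬ Late f i ∧ ¬ Late f j ∧ i < j) ∨
      (Late f i ∧ Late f j ∧ j < i) := by
  simp only [LtX, leX_ordTm, Rel, lt_iff_le_not_ge]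
  tauto

/-- Whatever lies below an early number is early and smaller as a number, so an early start would
give an infinite descent. -/
theorem late_of_descending {y : M.D Ty.one}
    (h : ∀ n : M.N, LtX (M.eval Env.nil ordTm ⬪ f) (y ⬪ (n + 1)) (y ⬪ n)) :
    Late f (y ⬪ (0 : M.N)) := by
  by_contra h0
  refine false_of_descent (M.eval Env.nil earlyTm ⬪ f) y ((earlyTm_app_eq_zero f).2 h0) ?_
  intro n
  have := ltX_ordTm.1 (h n)
  rw [earlyTm_app_eq_zero, earlyTm_app_eq_zero]
  tauto

/-- While an ascending sequence is early its values grow as numbers, so the value at `n` is late or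
at least `n`, hence late in any case. From then on the sequence stays late, where ascending in the
order means decreasing as numbers. -/
theorem not_ascending {n : M.N} (hn : f ⬪ n = (0 : M.N)) {y : M.D Ty.one}
    (h : ∀ n : M.N, LtX (M.eval Env.nil ordTm ⬪ f) (y ⬪ n) (y ⬪ (n + 1))) : False := by
  have key : ∀ k : M.N, k ≤ y ⬪ k ∨ Late f (y ⬪ k) := by
    intro k
    have := induct ((tmonus x0 (x2 ⬝ x0) ≐ tzero).or (lateTm.ofClosed ⬝ x1 ⬝ (x2 ⬝ x0) ≐ tzero))
      (by repeat constructor) ((Env.nil.cons y).cons f) ?_ ?_ k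
    · rw [sat_or] at this
      simpa [sub_eq_zero, lateTm_app_eq_zero] using this
    · rw [sat_or]
      simp [sub_eq_zero]
    · intro k
      rw [sat_or, sat_or]
      simp only [sat_eq, eval_app, eval_ofClosed, eval_var, eval_cst, cst_zero, Env.cons_zero,
        Env.cons_succ, monusTm_app, sub_eq_zero, lateTm_app_eq_zero]
      have h1 := ltX_ordTm.1 (h k)
      have h2 : k ≤ y ⬪ k → (y ⬪ k : M.N) < y ⬪ (k + 1) → k + 1 ≤ y ⬪ (k + 1) :=
        fun h h' => lt_iff_add_one_le.1 (h.trans_lt h')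
      tauto
  have hl : Late f (y ⬪ n) := (key n).elim (late_of_eq_zero hn).mono id
  -- The tail from `n` on must be an element of the model, so it is given by a term.
  let z : M.D Ty.one := M.eval ((Env.nil.cons n).cons y) (x1 ⬝ tadd x2 x0).lam
  have hz : ∀ k : M.N, z ⬪ k = y ⬪ (n + k) := fun k => by simp [z, lam_app]
  refine false_of_descent (M.eval Env.nil lateTm ⬪ f) z ?_ fun k => ?_
  · rwa [hz, add_zero, lateTm_app_eq_zero]
  · have := ltX_ordTm.1 (h (n + k))
    rw [hz, hz, lateTm_app_eq_zero, lateTm_app_eq_zero, ← add_assoc]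
    tauto

/-- Only the first value of the sequence given by `Ψ` matters: its lateness says that the search up
to it returns a zero. The environment `ρ` is left general so that the result applies both under a
quantifier and after a substitution. -/
theorem muTm_spec {Ψ : M.D (Ty.one ⟶ₜ Ty.one)}
    (hΨ : M.Sat (Env.nil.cons Ψ) UADSmatrix) (ρ : M.Env [Ty.two])
    (hρ : ρ _ .zero = M.eval Env.nil muTm ⬪ Ψ) : M.Sat ρ MUmatrix := by
  rw [sat_UADSmatrix] at hΨ
  rw [sat_MUmatrix, hρ]
  rintro f ⟨n, hn⟩
  have : Late f (Ψ ⬪ (M.eval Env.nil ordTm ⬪ f) ⬪ (0 : M.N)) :=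
    (hΨ _ isLOinf_ordTm).elim (fun h => (not_ascending hn h).elim) late_of_descending
  rw [muTm, lam_app, lam_app]
  simpa [Late] using this

end Model

/-! ### Monotone sequences from `μ` -/

section
variable {Γ : List Ty}

/-- Truth is the value `0`, so the default `tone` means false. -/
abbrev tand (c d : Tm Γ Ty.nat) : Tm Γ Ty.nat := tcond c d tone

abbrev tnot (c : Tm Γ Ty.nat) : Tm Γ Ty.nat := tcond c tone tzero

/-- `0` if and only if `a = b`. -/
abbrev teq (a b : Tm Γ Ty.nat) : Tm Γ Ty.nat := tadd (tmonus a b) (tmonus b a)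

/-- `0` if and only if `a < b`. -/
abbrev tlt (a b : Tm Γ Ty.nat) : Tm Γ Ty.nat := tmonus (tsucc a) b

end

/-! In the following terms, truth is coded by the value `0`. -/

/-- `exTm ⬝ μ ⬝ f`: the function `f` has a zero. -/
def exTm : Tm [] (Ty.two ⟶ₜ Ty.one ⟶ₜ Ty.nat) := (x0 ⬝ (x1 ⬝ x0)).lam.lam

/-- `fieldTm ⬝ X ⬝ a`: the number `a` is in the field of `X`. -/
def fieldTm : Tm [] (Ty.one ⟶ₜ Ty.nat ⟶ₜ Ty.nat) := (teq (x1 ⬝ tpair x0 x0) tone).lam.lam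

/-- `ltTm ⬝ X ⬝ a ⬝ b`: `a <_X b`. -/
def ltTm : Tm [] (Ty.one ⟶ₜ Ty.nat ⟶ₜ Ty.nat ⟶ₜ Ty.nat) :=
  (tand (teq (x2 ⬝ tpair x1 x0) tone) (tnot (teq (x2 ⬝ tpair x0 x1) tone))).lam.lam.lam

/-- `belowTm ⬝ X ⬝ a ⬝ m ⬝ b`: `b <_X a` and `m < b`. -/
def belowTm : Tm [] (Ty.one ⟶ₜ Ty.nat ⟶ₜ Ty.nat ⟶ₜ Ty.nat ⟶ₜ Ty.nat) :=
  (tand (ltTm.ofClosed ⬝ x3 ⬝ x0 ⬝ x2) (tlt x1 x0)).lam.lam.lam.lam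

/-- `boundTm ⬝ μ ⬝ X ⬝ a ⬝ m`: the predecessors of `a` are bounded by `m`. -/
def boundTm : Tm [] (Ty.two ⟶ₜ Ty.one ⟶ₜ Ty.nat ⟶ₜ Ty.nat ⟶ₜ Ty.nat) :=
  (tnot (exTm.ofClosed ⬝ x3 ⬝ (belowTm.ofClosed ⬝ x2 ⬝ x1 ⬝ x0))).lam.lam.lam.lam

/-- `lowTm ⬝ μ ⬝ X ⬝ a`: the element `a` has finitely many predecessors. -/
def lowTm : Tm [] (Ty.two ⟶ₜ Ty.one ⟶ₜ Ty.nat ⟶ₜ Ty.nat) :=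
  (tand (fieldTm.ofClosed ⬝ x1 ⬝ x0)
    (exTm.ofClosed ⬝ x2 ⬝ (boundTm.ofClosed ⬝ x2 ⬝ x1 ⬝ x0))).lam.lam.lam

/-- `highTm ⬝ μ ⬝ X ⬝ a`: the element `a` has infinitely many predecessors. -/
def highTm : Tm [] (Ty.two ⟶ₜ Ty.one ⟶ₜ Ty.nat ⟶ₜ Ty.nat) :=
  (tand (fieldTm.ofClosed ⬝ x1 ⬝ x0) (tnot (lowTm.ofClosed ⬝ x2 ⬝ x1 ⬝ x0))).lam.lam.lam

/-- `lowAboveTm ⬝ μ ⬝ X ⬝ k ⬝ a`: `a` is low and `k < a`. -/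
def lowAboveTm : Tm [] (Ty.two ⟶ₜ Ty.one ⟶ₜ Ty.nat ⟶ₜ Ty.nat ⟶ₜ Ty.nat) :=
  (tand (lowTm.ofClosed ⬝ x3 ⬝ x2 ⬝ x0) (tlt x1 x0)).lam.lam.lam.lam

/-- `lowBddTm ⬝ μ ⬝ X ⬝ k`: the low elements are bounded by `k`. -/
def lowBddTm : Tm [] (Ty.two ⟶ₜ Ty.one ⟶ₜ Ty.nat ⟶ₜ Ty.nat) :=
  (tnot (exTm.ofClosed ⬝ x2 ⬝ (lowAboveTm.ofClosed ⬝ x2 ⬝ x1 ⬝ x0))).lam.lam.lam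

/-- `ascCondTm ⬝ μ ⬝ X ⬝ p ⬝ b`: `b` is low and `p <_X b`. -/
def ascCondTm : Tm [] (Ty.two ⟶ₜ Ty.one ⟶ₜ Ty.nat ⟶ₜ Ty.nat ⟶ₜ Ty.nat) :=
  (tand (lowTm.ofClosed ⬝ x3 ⬝ x2 ⬝ x0) (ltTm.ofClosed ⬝ x2 ⬝ x1 ⬝ x0)).lam.lam.lam.lam

/-- `descCondTm ⬝ μ ⬝ X ⬝ p ⬝ b`: `b` is high and `b <_X p`. -/
def descCondTm : Tm [] (Ty.two ⟶ₜ Ty.one ⟶ₜ Ty.nat ⟶ₜ Ty.nat ⟶ₜ Ty.nat) :=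
  (tand (highTm.ofClosed ⬝ x3 ⬝ x2 ⬝ x0) (ltTm.ofClosed ⬝ x2 ⬝ x0 ⬝ x1)).lam.lam.lam.lam

def ascStepTm : Tm [] (Ty.two ⟶ₜ Ty.one ⟶ₜ Ty.nat ⟶ₜ Ty.nat ⟶ₜ Ty.nat) :=
  (x3 ⬝ (ascCondTm.ofClosed ⬝ x3 ⬝ x2 ⬝ x1)).lam.lam.lam.lam

def descStepTm : Tm [] (Ty.two ⟶ₜ Ty.one ⟶ₜ Ty.nat ⟶ₜ Ty.nat ⟶ₜ Ty.nat) :=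
  (x3 ⬝ (descCondTm.ofClosed ⬝ x3 ⬝ x2 ⬝ x1)).lam.lam.lam.lam

/-- An ascending sequence of low elements. -/
def ascTm : Tm [] (Ty.two ⟶ₜ Ty.one ⟶ₜ Ty.one) :=
  (trec ⬝ x0 ⬝ (x2 ⬝ (lowTm.ofClosed ⬝ x2 ⬝ x1)) ⬝ (ascStepTm.ofClosed ⬝ x2 ⬝ x1)).lam.lam.lam

/-- A descending sequence of high elements. -/
def descTm : Tm [] (Ty.two ⟶ₜ Ty.one ⟶ₜ Ty.one) :=
  (trec ⬝ x0 ⬝ (x2 ⬝ (highTm.ofClosed ⬝ x2 ⬝ x1)) ⬝ (descStepTm.ofClosed ⬝ x2 ⬝ x1)).lam.lam.lam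

/-- The functional `Ψ` defined from `μ`. -/
def psiTm : Tm [] (Ty.two ⟶ₜ Ty.one ⟶ₜ Ty.one) :=
  (tcond (exTm.ofClosed ⬝ x2 ⬝ (lowBddTm.ofClosed ⬝ x2 ⬝ x1))
    (descTm.ofClosed ⬝ x2 ⬝ x1 ⬝ x0) (ascTm.ofClosed ⬝ x2 ⬝ x1 ⬝ x0)).lam.lam.lam

/-! ### From `μ` to `Ψ`: low and high elements -/

namespace Model

open TyStr

variable {M : Model}

theorem ite_one_eq_zero {c : Prop} [Decidable c] {d : M.N} :
    (if c then d else 1) = 0 ↔ c ∧ d = 0 := by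
  split_ifs with h <;> simp [h, one_ne_zero]

theorem sub_add_sub_eq_zero {a b : M.N} : (a - b) + (b - a) = 0 ↔ a = b := by
  rw [add_eq_zero, sub_eq_zero, sub_eq_zero, le_antisymm_iff]

theorem fieldTm_app {X : M.D Ty.one} {a : M.N} :
    M.eval Env.nil fieldTm ⬪ X ⬪ a = (0 : M.N) ↔ LeX X a a := by
  rw [fieldTm, lam_app, lam_app]
  simp [sub_add_sub_eq_zero, LeX, pair, -add_eq_zero]

theorem ltTm_app {X : M.D Ty.one} {a b : M.N} :
    M.eval Env.nil ltTm ⬪ X ⬪ a ⬪ b = (0 : M.N) ↔ LtX X a b := by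
  rw [ltTm, lam_app, lam_app, lam_app]
  simp [sub_add_sub_eq_zero, LtX, LeX, pair, ite_one_eq_zero, one_ne_zero, -add_eq_zero]

theorem belowTm_app {X : M.D Ty.one} {a m b : M.N} :
    M.eval Env.nil belowTm ⬪ X ⬪ a ⬪ m ⬪ b = (0 : M.N) ↔ LtX X b a ∧ m < b := by
  classical
  rw [belowTm, lam_app, lam_app, lam_app, lam_app]
  simp [ltTm_app, ite_one_eq_zero, sub_eq_zero, lt_iff_add_one_le]

/-- `a` has finitely many predecessors. -/
def Low (X : M.D Ty.one) (a : M.N) : Prop :=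
  LeX X a a ∧ ∃ m : M.N, ∀ b : M.N, LtX X b a → b ≤ m

/-- A low `b` that is numerically larger than `a` and than a bound for the predecessors of `a` is
neither `a` nor below it, so by totality it is above. -/
theorem exists_low_gt {X : M.D Ty.one} (hX : IsLOinf X) (hl : ∀ k, ∃ a, Low X a ∧ k < a) {a : M.N}
    (ha : Low X a) : ∃ b, Low X b ∧ LtX X a b := by
  obtain ⟨haa, m, hm⟩ := ha
  obtain ⟨b, hb, hlt⟩ := hl (max m a)
  obtain ⟨h1, h2⟩ := max_lt_iff.1 hlt
  have hba : ¬ LtX X b a := fun h => absurd (hm b h) (not_le.2 h1)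
  have hn : ¬ LeX X b a := fun h =>
    hba ⟨h, fun h' => h2.ne (hX.antisymm _ _ h' h)⟩
  exact ⟨b, hb, (hX.total a b haa hb.1).resolve_right hn, hn⟩

/-- If no high element were below `a`, all predecessors of `a` would be low, hence bounded by `k`,
and `a` would be low. -/
theorem exists_high_lt {X : M.D Ty.one} (hX : IsLOinf X) {k : M.N} (hl : ∀ a, Low X a → a ≤ k)
    {a : M.N} (ha : LeX X a a ∧ ¬ Low X a) : ∃ b, (LeX X b b ∧ ¬ Low X b) ∧ LtX X b a := by
  by_contra! h
  refine ha.2 ⟨ha.1, k, fun b hb => ?_⟩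
  by_contra hbk
  exact h b ⟨(hX.field _ _ hb.1).1, fun hb' => hbk (hl b hb')⟩ hb

section
variable {μ : M.D Ty.two}
  (hμ : ∀ f : M.D Ty.one, (∃ n : M.N, f ⬪ n = (0 : M.N)) → f ⬪ (μ ⬪ f) = (0 : M.N))
include hμ

/-- Testing `f` at `μ f` decides an existential statement. Nesting this test decides lowness and the
boundedness of the low elements. -/
theorem exTm_app {f : M.D Ty.one} :
    M.eval Env.nil exTm ⬪ μ ⬪ f = (0 : M.N) ↔ ∃ n : M.N, f ⬪ n = (0 : M.N) := by
  rw [exTm, lam_app, lam_app]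
  exact ⟨fun h => ⟨_, h⟩, hμ f⟩

variable {X : M.D Ty.one}

theorem boundTm_app {a m : M.N} :
    M.eval Env.nil boundTm ⬪ μ ⬪ X ⬪ a ⬪ m = (0 : M.N) ↔ ∀ b : M.N, LtX X b a → b ≤ m := by
  classical
  rw [boundTm, lam_app, lam_app, lam_app, lam_app]
  simp [exTm_app hμ, belowTm_app, one_ne_zero]

theorem lowTm_app {a : M.N} :
    M.eval Env.nil lowTm ⬪ μ ⬪ X ⬪ a = (0 : M.N) ↔ Low X a := by
  classical
  rw [lowTm, lam_app, lam_app, lam_app]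
  simp [exTm_app hμ, boundTm_app hμ, fieldTm_app, ite_one_eq_zero, Low]

theorem highTm_app {a : M.N} :
    M.eval Env.nil highTm ⬪ μ ⬪ X ⬪ a = (0 : M.N) ↔ LeX X a a ∧ ¬ Low X a := by
  classical
  rw [highTm, lam_app, lam_app, lam_app]
  simp [lowTm_app hμ, fieldTm_app, ite_one_eq_zero, one_ne_zero]

theorem lowBddTm_app {k : M.N} :
    M.eval Env.nil lowBddTm ⬪ μ ⬪ X ⬪ k = (0 : M.N) ↔ ∀ a, Low X a → a ≤ k := by
  classical
  rw [lowBddTm, lam_app, lam_app, lam_app]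
  simp [exTm_app hμ, lowAboveTm, lam_app, lowTm_app hμ, ite_one_eq_zero, one_ne_zero,
    sub_eq_zero, ← lt_iff_add_one_le]

theorem ascCondTm_app {p b : M.N} :
    M.eval Env.nil ascCondTm ⬪ μ ⬪ X ⬪ p ⬪ b = (0 : M.N) ↔ Low X b ∧ LtX X p b := by
  classical
  rw [ascCondTm, lam_app, lam_app, lam_app, lam_app]
  simp [lowTm_app hμ, ltTm_app, ite_one_eq_zero]

theorem descCondTm_app {p b : M.N} :
    M.eval Env.nil descCondTm ⬪ μ ⬪ X ⬪ p ⬪ b = (0 : M.N) ↔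
      (LeX X b b ∧ ¬ Low X b) ∧ LtX X b p := by
  classical
  rw [descCondTm, lam_app, lam_app, lam_app, lam_app]
  simp [highTm_app hμ, ltTm_app, ite_one_eq_zero]

theorem ascending_ascTm (hX : IsLOinf X) (hl : ∀ k, ∃ a, Low X a ∧ k < a) (n : M.N) :
    LtX X (M.eval Env.nil ascTm ⬪ μ ⬪ X ⬪ n) (M.eval Env.nil ascTm ⬪ μ ⬪ X ⬪ (n + 1)) := by
  have e : ∀ n : M.N, M.eval Env.nil ascTm ⬪ μ ⬪ X ⬪ n = recN n
      (μ ⬪ (M.eval Env.nil lowTm ⬪ μ ⬪ X)) (M.eval Env.nil ascStepTm ⬪ μ ⬪ X) := fun n => by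
    rw [ascTm, lam_app, lam_app, lam_app]
    simp
  have e0 : M.eval Env.nil ascTm ⬪ μ ⬪ X ⬪ (0 : M.N) = μ ⬪ (M.eval Env.nil lowTm ⬪ μ ⬪ X) := by
    rw [e, recN_zero]
  have es : ∀ n : M.N, M.eval Env.nil ascTm ⬪ μ ⬪ X ⬪ (n + 1) =
      μ ⬪ (M.eval Env.nil ascCondTm ⬪ μ ⬪ X ⬪ (M.eval Env.nil ascTm ⬪ μ ⬪ X ⬪ n)) := fun n => by
    rw [e, recN_succ, ← e, ascStepTm]
    simp [lam_app]
  have step : ∀ n : M.N, Low X (M.eval Env.nil ascTm ⬪ μ ⬪ X ⬪ n) →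
      Low X (M.eval Env.nil ascTm ⬪ μ ⬪ X ⬪ (n + 1)) ∧
        LtX X (M.eval Env.nil ascTm ⬪ μ ⬪ X ⬪ n)
          (M.eval Env.nil ascTm ⬪ μ ⬪ X ⬪ (n + 1)) := fun n hn => by
    -- The next value is what `μ` returns for the condition on it, so it is correct as soon as some
    -- number satisfies the condition.
    rw [es, ← ascCondTm_app hμ]
    refine hμ _ ?_
    obtain ⟨b, hb⟩ := exists_low_gt hX hl hn
    exact ⟨b, (ascCondTm_app hμ).2 hb⟩
  refine (step n ?_).2
  -- Lowness is defined with quantifiers; expressed through `lowTm` it becomes an equation, to which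
  -- induction applies.
  have := induct (lowTm.ofClosed ⬝ x2 ⬝ x1 ⬝ (ascTm.ofClosed ⬝ x2 ⬝ x1 ⬝ x0) ≐ tzero) (.eq _ _)
    ((Env.nil.cons μ).cons X) ?_ ?_ n
  · simpa [lowTm_app hμ] using this
  · simp only [sat_eq, eval_app, eval_ofClosed, eval_var, Env.cons_zero, Env.cons_succ,
      eval_cst, cst_zero, e0]
    obtain ⟨a, ha, -⟩ := hl 0
    exact hμ _ ⟨a, (lowTm_app hμ).2 ha⟩
  · intro n
    simp only [sat_eq, eval_app, eval_ofClosed, eval_var, Env.cons_zero, Env.cons_succ,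
      eval_cst, cst_zero, lowTm_app hμ]
    exact fun h => (step n h).1

theorem descending_descTm (hX : IsLOinf X) {k : M.N} (hl : ∀ a, Low X a → a ≤ k) (n : M.N) :
    LtX X (M.eval Env.nil descTm ⬪ μ ⬪ X ⬪ (n + 1)) (M.eval Env.nil descTm ⬪ μ ⬪ X ⬪ n) := by
  have e : ∀ n : M.N, M.eval Env.nil descTm ⬪ μ ⬪ X ⬪ n = recN n
      (μ ⬪ (M.eval Env.nil highTm ⬪ μ ⬪ X)) (M.eval Env.nil descStepTm ⬪ μ ⬪ X) := fun n => by
    rw [descTm, lam_app, lam_app, lam_app]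
    simp
  have e0 : M.eval Env.nil descTm ⬪ μ ⬪ X ⬪ (0 : M.N) =
      μ ⬪ (M.eval Env.nil highTm ⬪ μ ⬪ X) := by
    rw [e, recN_zero]
  have es : ∀ n : M.N, M.eval Env.nil descTm ⬪ μ ⬪ X ⬪ (n + 1) =
      μ ⬪ (M.eval Env.nil descCondTm ⬪ μ ⬪ X ⬪ (M.eval Env.nil descTm ⬪ μ ⬪ X ⬪ n)) :=
    fun n => by
      rw [e, recN_succ, ← e, descStepTm]
      simp [lam_app]
  have step : ∀ n : M.N, M.eval Env.nil highTm ⬪ μ ⬪ X ⬪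
      (M.eval Env.nil descTm ⬪ μ ⬪ X ⬪ n) = (0 : M.N) →
      M.eval Env.nil highTm ⬪ μ ⬪ X ⬪ (M.eval Env.nil descTm ⬪ μ ⬪ X ⬪ (n + 1)) = (0 : M.N) ∧
        LtX X (M.eval Env.nil descTm ⬪ μ ⬪ X ⬪ (n + 1))
          (M.eval Env.nil descTm ⬪ μ ⬪ X ⬪ n) := fun n hn => by
    rw [es, highTm_app hμ, ← descCondTm_app hμ]
    refine hμ _ ?_
    obtain ⟨b, hb⟩ := exists_high_lt hX hl ((highTm_app hμ).1 hn)
    exact ⟨b, (descCondTm_app hμ).2 hb⟩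
  refine (step n ?_).2
  have := induct (highTm.ofClosed ⬝ x2 ⬝ x1 ⬝ (descTm.ofClosed ⬝ x2 ⬝ x1 ⬝ x0) ≐ tzero) (.eq _ _)
    ((Env.nil.cons μ).cons X) ?_ ?_ n
  · simpa using this
  · simp only [sat_eq, eval_app, eval_ofClosed, eval_var, Env.cons_zero, Env.cons_succ,
      eval_cst, cst_zero, e0]
    -- A high element to start from: a field element beyond `k` cannot be low.
    obtain ⟨a, ha, hk⟩ := hX.unbounded k
    exact hμ _ ⟨a, (highTm_app hμ).2 ⟨ha, fun h => absurd (hl a h) (not_le.2 hk)⟩⟩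
  · intro n
    simp only [sat_eq, eval_app, eval_ofClosed, eval_var, Env.cons_zero, Env.cons_succ,
      eval_cst, cst_zero]
    exact fun h => (step n h).1

end

/-- The case distinction depends on `X` alone and not on `n`, so the whole sequence is the ascending
or the descending one. -/
theorem psiTm_spec {μ : M.D Ty.two} (hμ : M.Sat (Env.nil.cons μ) MUmatrix)
    (ρ : M.Env [Ty.one ⟶ₜ Ty.one]) (hρ : ρ _ .zero = M.eval Env.nil psiTm ⬪ μ) :
    M.Sat ρ UADSmatrix := by
  rw [sat_MUmatrix] at hμ
  replace hμ : ∀ f : M.D Ty.one, (∃ n : M.N, f ⬪ n = (0 : M.N)) → f ⬪ (μ ⬪ f) = (0 : M.N) := hμ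
  rw [sat_UADSmatrix, hρ]
  intro X hX
  classical
  have e : ∀ n : M.N, M.eval Env.nil psiTm ⬪ μ ⬪ X ⬪ n =
      if ∃ k : M.N, ∀ a, Low X a → a ≤ k then M.eval Env.nil descTm ⬪ μ ⬪ X ⬪ n
      else M.eval Env.nil ascTm ⬪ μ ⬪ X ⬪ n := fun n => by
    rw [psiTm, lam_app, lam_app, lam_app]
    simp only [eval_app, eval_ofClosed, eval_var, Env.cons_zero, Env.cons_succ, condTm_app,
      exTm_app hμ, lowBddTm_app hμ]
  simp only [e]
  split_ifs with h
  · obtain ⟨k, hk⟩ := h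
    exact .inr (descending_descTm hμ hX hk)
  · push Not at h
    exact .inl (ascending_ascTm hμ hX h)

end Model

end RCAω

/-! ### The equivalence, by completeness -/

theorem mainTheorem3 :
    RCAω.Provable (RCAω.UADS.iff RCAω.muSquared) ∧
      RCAω.ExplicitImp RCAω.UADSmatrix RCAω.MUmatrix ∧
      RCAω.ExplicitImp RCAω.MUmatrix RCAω.UADSmatrix := by
  refine ⟨RCAω.provable_of_forall_model fun M => ?_,
    ⟨RCAω.muTm, RCAω.provable_of_forall_model fun M => ?_⟩,
    ⟨RCAω.psiTm, RCAω.provable_of_forall_model fun M => ?_⟩⟩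
  · refine (RCAω.TyStr.sat_and _ _ _).2 ⟨fun h => ?_, fun h => ?_⟩
    · obtain ⟨Ψ, hΨ⟩ := (RCAω.TyStr.sat_ex _ _ _).1 h
      exact (RCAω.TyStr.sat_ex _ _ _).2 ⟨_, RCAω.Model.muTm_spec hΨ _ rfl⟩
    · obtain ⟨μ, hμ⟩ := (RCAω.TyStr.sat_ex _ _ _).1 h
      exact (RCAω.TyStr.sat_ex _ _ _).2 ⟨_, RCAω.Model.psiTm_spec hμ _ rfl⟩
  · intro Ψ hΨ
    rw [RCAω.TyStr.sat_subst]
    exact RCAω.Model.muTm_spec hΨ _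
      (congrArg (M.app · Ψ) (RCAω.TyStr.eval_ofClosed _ RCAω.muTm))
  · intro μ hμ
    rw [RCAω.TyStr.sat_subst]
    exact RCAω.Model.psiTm_spec hμ _
      (congrArg (M.app · μ) (RCAω.TyStr.eval_ofClosed _ RCAω.psiTm))
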